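/- Let $d\ge 1$, let $\langle x,y\rangle_L=x_1y_1+\dots+x_dy_d-x_{d+1}y_{d+1}$ on $\mathbb R^{d,1}$, and let $\mathbb H^d=\{q:\langle q,q\rangle_L=-1,\ q_{d+1}>0\}$ be hyperbolic space with the metric induced by $\langle\cdot,\cdot\rangle_L$ and distance $\theta(q,Z)=\operatorname{arcosh}(-\langle q,Z\rangle_L)$. Let $e\in\mathbb R^d$ be a unit vector, $0<a<1$, and let $Z_1,Z_2,O\in\mathbb H^d$ be the points whose central projections to $\mathbb R^d\times\{1\}$ are $ae$, $-ae$, $0$. Let $m_1>0$ and $m_2,f\in\mathbb R$. The tangent bundle $T\mathbb H^d$ carries the Poisson bracket $\{\cdot,\cdot\}$ transported from $T^*\mathbb H^d$ by the Legendre transformation. Let $$E_{Kep}(q,v)=\tfrac12\langle v,v\rangle_L-m_1\coth\theta(q,Z_1)$$ be the energy of the hyperbolic Kepler problem $\nabla_{\dot q}\dot q=-\operatorname{grad}\bigl(-m_1\coth\theta(q,Z_1)\bigr)$. Let $\mathcal R\subset T\mathbb H^d$ be the set of points through which the Kepler orbit is non-singular, defined for all times and closed (periodic), and does not pass through $Z_2$.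 Let $V_2$ be either of the perturbing potentials $$-m_2\coth\theta(q,Z_2)\quad\text{(two-center problem)},\qquad -m_2\coth\theta(q,Z_2)+f\tanh^2\theta(q,O)\quad\text{(Lagrange problem)},$$ and define the Hamiltonian of the partially-averaged system on $\mathcal R$ by $$E_a=E_{Kep}+\frac1T\int_0^T V_2(q(t))\,dt,$$ where $t\mapsto q(t)$ is the closed Kepler orbit through the given point and $T>0$ is a period of it. Let $D=C^2-2hA_1$, where the right-hand side is computed in the chart of central projection, as follows. Equip $\mathbb R^d$ with the scalar product $\langle x,y\rangle_a=x\cdot y+\bigl(\tfrac1{1-a^2}-1\bigr)(x\cdot e)(y\cdot e)$ and norm $|\cdot|_a$. For $(q,v)\in T\mathbb H^d$ write $q=(q_s,q_t)$, $v=(v_s,v_t)$ with $q_s,v_s\in\mathbb R^d$ and $q_t,v_t\in\mathbb R$, and put $y=q_s/q_t-ae$, $w=q_tv_s-v_tq_s$ (position relative to the first center, and velocity in the time $\tau$ with $d\tau=dt/q_t^2$), and $\mu=m_1/\sqrt{1-a^2}$. Then $$C^2=|y|_a^2|w|_a^2-\langle y,w\rangle_a^2,\qquad h=\frac a{\sqrt{1-a^2}},\qquad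 A_1=\Bigl\langle |w|_a^2\,y-\langle y,w\rangle_a\,w-\mu\frac{y}{|y|_a},\ -\sqrt{1-a^2}\,e\Bigr\rangle_a,$$ i.e. $C$ is the angular momentum about the first center, $h$ is half of the distance between the two centers, and $A_1$ is the component of the Laplace-Runge-Lenz vector in the direction from the first center to the second. Then, for the two-center problem as well as for the Lagrange problem, $E_a$ and $D$ are differentiable at every point of $\mathcal R$, and $D$ is a first integral of the partially-averaged system: $\{E_a,D\}=0$ on $\mathcal R$. -/

import Mathlib

noncomputable section

namespace HypKepler

/-- Euclidean space `ℝ^d`. -/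
abbrev Eu (d : ℕ) : Type := EuclideanSpace ℝ (Fin d)

/-- The vector space underlying `ℝ^{d,1}`: spatial part and time coordinate. -/
abbrev Mink (d : ℕ) : Type := Eu d × ℝ

/-- The Lorentz form `x₁y₁ + ⋯ + x_d y_d - x_{d+1} y_{d+1}` of `ℝ^{d,1}`. -/
def mink {d : ℕ} (x y : Mink d) : ℝ := inner ℝ x.1 y.1 - x.2 * y.2

/-- Hyperbolic space `ℍ^d`: the upper sheet of the unit pseudosphere. -/
def Hyp (d : ℕ) : Set (Mink d) := {q | mink q q = -1 ∧ 0 < q.2}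

/-- The tangent bundle `Tℍ^d`, as pairs (position, velocity) in `ℝ^{d,1}`. -/
def THyp (d : ℕ) : Set (Mink d × Mink d) := {z | z.1 ∈ Hyp d ∧ mink z.1 z.2 = 0}

/-- Hyperbolic distance (for `q, z` on `ℍ^d`). -/
def hdist {d : ℕ} (q z : Mink d) : ℝ := Real.arcosh (-mink q z)

/-- Hyperbolic cotangent. -/
def coth (θ : ℝ) : ℝ := Real.cosh θ / Real.sinh θ

/-- Hyperbolic Kepler potential of a center `Z` of mass `m`. -/
def keplerPot {d : ℕ} (m : ℝ) (Z q : Mink d) : ℝ := -(m * coth (hdist q Z))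

/-- Hyperbolic Hooke potential with center `Z` and factor `f`. -/
def hookePot {d : ℕ} (f : ℝ) (Z q : Mink d) : ℝ := f * Real.tanh (hdist q Z) ^ 2

/-- The point of `ℍ^d` whose central projection to `ℝ^d × {1}` is `x`, where `‖x‖ < 1`. -/
def lift {d : ℕ} (x : Eu d) : Mink d :=
  ((√(1 - ‖x‖ ^ 2))⁻¹ • x, (√(1 - ‖x‖ ^ 2))⁻¹)

/-! ### Kepler motion -/

/-- `q`, with velocity `v`, is a non-singular motion, defined for all times, in the hyperbolic
Kepler problem with center `Z` of mass `m`, i.e. a solution of `∇_{q'} q' = -grad V`.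
The covariant acceleration is the tangential part of `q'' = A`; the equation is tested against
all tangent vectors `w` at `q t`. -/
structure IsKeplerMotion {d : ℕ} (m : ℝ) (Z : Mink d) (q v : ℝ → Mink d) : Prop where
  mem_hyp : ∀ t, q t ∈ Hyp d
  ne_center : ∀ t, q t ≠ Z
  hasDerivAt_pos : ∀ t, HasDerivAt q (v t) t
  newton : ∀ t, ∃ A : Mink d, HasDerivAt v A t ∧
    ∀ w : Mink d, mink (q t) w = 0 → mink A w = -fderiv ℝ (keplerPot m Z) (q t) w

/-- `q`, with velocity `v`, is a closed non-singular Kepler orbit with period `T` that starts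
at the point `z` of the tangent bundle. -/
structure IsClosedOrbit {d : ℕ} (m : ℝ) (Z : Mink d) (z : Mink d × Mink d)
    (q v : ℝ → Mink d) (T : ℝ) : Prop where
  motion : IsKeplerMotion m Z q v
  start : (q 0, v 0) = z
  period_pos : 0 < T
  periodic : Function.Periodic q T

/-- The averaging region: the points of `Tℍ^d` whose Kepler orbit with respect to `Z` is
closed and does not pass through the other center `Z'`. -/
def region {d : ℕ} (m : ℝ) (Z Z' : Mink d) : Set (Mink d × Mink d) :=
  {z | z ∈ THyp d ∧ ∃ (q v : ℝ → Mink d) (T : ℝ),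
    IsClosedOrbit m Z z q v T ∧ ∀ t, q t ≠ Z'}

open Classical in
/-- The average of `V` over the closed Kepler orbit through `z`, parametrized proportionally to
time by the circle. (The orbit is unique, and every period gives the same average; the value is
`0` where there is no closed orbit.) -/
def orbitMean {d : ℕ} (m : ℝ) (Z : Mink d) (V : Mink d → ℝ) (z : Mink d × Mink d) : ℝ :=
  if h : ∃ o : (ℝ → Mink d) × (ℝ → Mink d) × ℝ, IsClosedOrbit m Z z o.1 o.2.1 o.2.2 then
    (h.choose.2.2)⁻¹ * ∫ t in (0 : ℝ)..h.choose.2.2, V (h.choose.1 t)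
  else 0

/-- The energy of the hyperbolic Kepler problem. -/
def keplerEnergy {d : ℕ} (m : ℝ) (Z : Mink d) (z : Mink d × Mink d) : ℝ :=
  mink z.2 z.2 / 2 + keplerPot m Z z.1

/-- The Hamiltonian of the partially-averaged system for the perturbing potential `V`. -/
def averagedEnergy {d : ℕ} (m : ℝ) (Z : Mink d) (V : Mink d → ℝ) (z : Mink d × Mink d) : ℝ :=
  keplerEnergy m Z z + orbitMean m Z V z

/-! ### The Poisson bracket of `Tℍ^d`

`ℍ^d` carries the global coordinates `s ∈ ℝ^d`, `q = (s, √(1 + |s|²))`; with the conjugate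
momenta `p` they are canonical coordinates of `T^*ℍ^d`, and the Legendre transformation
identifies `T^*ℍ^d` with `Tℍ^d`. -/

/-- The point of `Tℍ^d` with canonical coordinates `(s, p)`. -/
def ofCanonical {d : ℕ} (c : Eu d × Eu d) : Mink d × Mink d :=
  ((c.1, √(1 + ‖c.1‖ ^ 2)),
   (c.2 + inner ℝ c.1 c.2 • c.1, √(1 + ‖c.1‖ ^ 2) * inner ℝ c.1 c.2))

/-- The canonical coordinates `(s, p)` of a point of `Tℍ^d`. -/
def toCanonical {d : ℕ} (z : Mink d × Mink d) : Eu d × Eu d :=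
  (z.1.1, z.2.1 - (z.2.2 / z.1.2) • z.1.1)

/-- The canonical Poisson bracket on `ℝ^d × ℝ^d`. -/
def canonicalBracket {d : ℕ} (F G : Eu d × Eu d → ℝ) (c : Eu d × Eu d) : ℝ :=
  ∑ i : Fin d,
    (fderiv ℝ F c (EuclideanSpace.single i 1, 0) * fderiv ℝ G c (0, EuclideanSpace.single i 1)
      - fderiv ℝ F c (0, EuclideanSpace.single i 1) * fderiv ℝ G c (EuclideanSpace.single i 1, 0))

/-- The Poisson bracket on `Tℍ^d`, transported from `T^*ℍ^d`. -/
def poisson {d : ℕ} (F G : Mink d × Mink d → ℝ) (z : Mink d × Mink d) : ℝ :=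
  canonicalBracket (F ∘ ofCanonical) (G ∘ ofCanonical) (toCanonical z)

/-- Differentiability of a function on `Tℍ^d` at a point. -/
def DiffAtTHyp {d : ℕ} (F : Mink d × Mink d → ℝ) (z : Mink d × Mink d) : Prop :=
  DifferentiableAt ℝ (F ∘ ofCanonical) (toCanonical z)

theorem ofCanonical_mem {d : ℕ} (c : Eu d × Eu d) : ofCanonical c ∈ THyp d := by
  have h : (0 : ℝ) < 1 + ‖c.1‖ ^ 2 := by positivity
  have h2 := Real.mul_self_sqrt h.le
  refine ⟨⟨?_, Real.sqrt_pos.2 h⟩, ?_⟩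
  · simp only [mink, ofCanonical, real_inner_self_eq_norm_sq]
    linarith
  · simp only [mink, ofCanonical, inner_add_right, inner_smul_right, real_inner_self_eq_norm_sq]
    linear_combination (-(inner ℝ c.1 c.2 : ℝ)) * h2

theorem toCanonical_ofCanonical {d : ℕ} (c : Eu d × Eu d) :
    toCanonical (ofCanonical c) = c := by
  have h : √(1 + ‖c.1‖ ^ 2) ≠ 0 := (Real.sqrt_pos.2 (by positivity)).ne'
  ext1
  · rfl
  · simp [toCanonical, ofCanonical, mul_div_cancel_left₀ _ h]

theorem ofCanonical_toCanonical {d : ℕ} {z : Mink d × Mink d} (hz : z ∈ THyp d) :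
    ofCanonical (toCanonical z) = z := by
  obtain ⟨⟨s, t⟩, ⟨u, r⟩⟩ := z
  obtain ⟨⟨h1, h2⟩, h3⟩ := hz
  simp only [mink, real_inner_self_eq_norm_sq] at h1 h2 h3
  have ht : √(1 + ‖s‖ ^ 2) = t := by
    rw [show 1 + ‖s‖ ^ 2 = t ^ 2 by linarith, Real.sqrt_sq h2.le]
  have hi : (inner ℝ s (u - (r / t) • s) : ℝ) = r / t := by
    rw [inner_sub_right, inner_smul_right, real_inner_self_eq_norm_sq,
      show ‖s‖ ^ 2 = t * t - 1 by linarith, show (inner ℝ s u : ℝ) = t * r by linarith]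
    field_simp
    ring
  simp only [ofCanonical, toCanonical, ht, hi, sub_add_cancel, mul_div_cancel₀ _ h2.ne']

/-- The coordinates `p` are the momenta conjugate to `s`: `p` pairs with `w` as the velocity
pairs, in the Lorentz form, with the tangent vector `∂q/∂s (w)` of `q = (s, √(1 + |s|²))`. -/
theorem inner_toCanonical_snd {d : ℕ} {z : Mink d × Mink d} (w : Eu d) :
    inner ℝ (toCanonical z).2 w = mink z.2 (w, inner ℝ z.1.1 w / z.1.2) := by
  simp only [toCanonical, mink, inner_sub_left, real_inner_smul_left]
  ring

/-! ### The function `D` -/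

/-- Position in the chart `ℝ^d` given by central projection to `ℝ^d × {1}`. -/
def chartPos {d : ℕ} (z : Mink d × Mink d) : Eu d := (z.1.2)⁻¹ • z.1.1

/-- Velocity in the chart, in the Euclidean time `τ` of the projective correspondence
(`dτ = dt / q_{d+1}²`). -/
def chartVel {d : ℕ} (z : Mink d × Mink d) : Eu d := z.1.2 • z.2.1 - z.2.2 • z.1.1

/-- The scalar product of the norm `‖·‖_a` on `ℝ^d`, whose square is the Euclidean one with the
squared component along the unit vector `e` divided by `1 - a²`. -/
def affInner {d : ℕ} (a : ℝ) (e x y : Eu d) : ℝ :=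
  inner ℝ x y + ((1 - a ^ 2)⁻¹ - 1) * (inner ℝ x e * inner ℝ y e)

/-- The squared angular momentum `C²` of position `y` and velocity `w`, with respect to the norm
`‖·‖_a`. -/
def angMomSq {d : ℕ} (a : ℝ) (e y w : Eu d) : ℝ :=
  affInner a e y y * affInner a e w w - affInner a e y w ^ 2

/-- The Laplace-Runge-Lenz vector `|w|² y - ⟨y, w⟩ w - μ y / |y|` of the Kepler problem of mass
`μ` in the norm `‖·‖_a`, with `y` the position relative to the center and `w` the velocity. -/
def lrl {d : ℕ} (μ a : ℝ) (e y w : Eu d) : Eu d :=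
  affInner a e w w • y - affInner a e y w • w - (μ / √(affInner a e y y)) • y

/-- `D = C² - 2 h A₁` as a function on `Tℍ^d`, the centers being the lifts of `± a e`. In the
chart, `C` and `A₁` belong to the Kepler center `a e` of mass `m / √(1 - a²)` (projectively
corresponding to the hyperbolic Kepler problem of mass `m`), `A₁` is the component of the
Laplace-Runge-Lenz vector along the unit vector `-√(1 - a²) e` from `a e` towards `-a e`, and
`h = a / √(1 - a²)` is half of the distance of the centers, all in the norm `‖·‖_a`. -/
def D {d : ℕ} (m a : ℝ) (e : Eu d) (z : Mink d × Mink d) : ℝ :=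
  angMomSq a e (chartPos z - a • e) (chartVel z)
    - 2 * (a / √(1 - a ^ 2)) *
      affInner a e (lrl (m / √(1 - a ^ 2)) a e (chartPos z - a • e) (chartVel z))
        (-√(1 - a ^ 2) • e)

/-! ### The two-center and Lagrange problems -/

/-- In the two-center problem with centers the lifts of `± a e`, the perturbation of the Kepler
problem of the first center: the Kepler potential of mass `m₂` of the second center. -/
def twoCenterPert {d : ℕ} (m₂ a : ℝ) (e : Eu d) (q : Mink d) : ℝ :=
  keplerPot m₂ (lift (-a • e)) q

/-- In the Lagrange problem, there is in addition a Hooke potential of factor `f` centered at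
the midpoint of the two Kepler centers. -/
def lagrangePert {d : ℕ} (m₂ f a : ℝ) (e : Eu d) (q : Mink d) : ℝ :=
  keplerPot m₂ (lift (-a • e)) q + hookePot f (lift 0) q

end HypKepler

end

/-!
Central projection, with the direction `e` rescaled so that `‖·‖_a` becomes the Euclidean norm and
the first center moved to the origin, turns the hyperbolic Kepler problem into the Euclidean one
of mass `μ`, up to a change of time. In terms of the eccentric anomaly, the closed orbits are
parametrized ellipses with a focus at the origin, and time averages are quotients of integrals
over the anomaly.

In this chart, the Hamiltonian field of `D` moves a Kepler ellipse by an infinitesimal rotation, a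
multiple of the deformation field `orbitShift` and a shift of the anomaly. The integrands that
occur, namely the rate of hyperbolic time and its products with the two kinds of perturbing
potentials, change under this motion by a total derivative with respect to the anomaly, so their
integrals over closed orbits do not change. The Kepler energy does not change either, since
`D` is a first integral of the Kepler problem; hence the averaged energy Poisson commutes
with `D`.
-/

noncomputable section

namespace HypKepler

section Calculus

open MeasureTheory intervalIntegral

variable {G : Type*} [NormedAddCommGroup G] [NormedSpace ℝ G]

lemma hasFDerivAt_div {f g : G → ℝ} {f' g' : G →L[ℝ] ℝ} {z : G} (hf : HasFDerivAt f f' z)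
    (hg : HasFDerivAt g g' z) (hgz : g z ≠ 0) :
    HasFDerivAt (fun x => f x / g x) ((g z ^ 2)⁻¹ • (g z • f' - f z • g')) z := by
  simp only [div_eq_mul_inv]
  refine (hf.mul ((hasDerivAt_inv hgz).comp_hasFDerivAt z hg)).congr_fderiv ?_
  ext v
  simp only [add_apply, sub_apply, smul_apply, smul_eq_mul, Function.comp_apply]
  field_simp
  ring

lemma hasDerivAt_add_smul (z v : G) : HasDerivAt (fun s : ℝ => z + s • v) v 0 := by
  simpa using ((hasDerivAt_id (0 : ℝ)).smul_const v).const_add z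

lemma hasDerivAt_fst_comp {F : Type*} [NormedAddCommGroup F] [NormedSpace ℝ F] {q : ℝ → G × F}
    {q' : G × F} {t : ℝ} (hq : HasDerivAt q q' t) : HasDerivAt (fun t => (q t).1) q'.1 t := by
  simpa using hq.hasFDerivAt.fst.hasDerivAt

lemma hasDerivAt_snd_comp {F : Type*} [NormedAddCommGroup F] [NormedSpace ℝ F] {q : ℝ → G × F}
    {q' : G × F} {t : ℝ} (hq : HasDerivAt q q' t) : HasDerivAt (fun t => (q t).2) q'.2 t := by
  simpa using hq.hasFDerivAt.snd.hasDerivAt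

/-- `f` is differentiable at `z` and does not change to first order when `z` moves with
velocity `v`. -/
structure IsInvariantAt (f : G → ℝ) (z v : G) : Prop where
  differentiableAt : DifferentiableAt ℝ f z
  fderiv_apply : fderiv ℝ f z v = 0

namespace IsInvariantAt

variable {f g : G → ℝ} {z v : G}

lemma of_hasFDerivAt {f' : G →L[ℝ] ℝ} (hf : HasFDerivAt f f' z) (hv : f' v = 0) :
    IsInvariantAt f z v :=
  ⟨hf.differentiableAt, by rw [hf.fderiv, hv]⟩

lemma of_line (hf : DifferentiableAt ℝ f z) (hv : HasDerivAt (fun s : ℝ => f (z + s • v)) 0 0) :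
    IsInvariantAt f z v :=
  ⟨hf, by rw [← hf.lineDeriv_eq_fderiv]; exact hv.deriv⟩

lemma congr_of_eventuallyEq (hf : IsInvariantAt f z v) (h : g =ᶠ[nhds z] f) :
    IsInvariantAt g z v :=
  ⟨hf.differentiableAt.congr_of_eventuallyEq h, by rw [h.fderiv_eq, hf.fderiv_apply]⟩

lemma add (hf : IsInvariantAt f z v) (hg : IsInvariantAt g z v) :
    IsInvariantAt (fun x => f x + g x) z v :=
  of_hasFDerivAt (hf.1.hasFDerivAt.add hg.1.hasFDerivAt) (by simp [hf.2, hg.2])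

lemma const_mul (hf : IsInvariantAt f z v) (c : ℝ) : IsInvariantAt (fun x => c * f x) z v :=
  of_hasFDerivAt (hf.1.hasFDerivAt.const_mul c) (by simp [hf.2])

lemma div (hf : IsInvariantAt f z v) (hg : IsInvariantAt g z v) (hgz : g z ≠ 0) :
    IsInvariantAt (fun x => f x / g x) z v :=
  of_hasFDerivAt (hasFDerivAt_div hf.1.hasFDerivAt hg.1.hasFDerivAt hgz) (by simp [hf.2, hg.2])

end IsInvariantAt

lemma hasFDerivAt_comp_prodMk {f : G × ℝ → ℝ} {z : G} {u : ℝ} (hf : DifferentiableAt ℝ f (z, u)) :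
    HasFDerivAt (fun x => f (x, u)) (fderiv ℝ f (z, u) ∘L .inl ℝ G ℝ) z :=
  hf.hasFDerivAt.comp z (hasFDerivAt_prodMk_left z u)

lemma continuousAt_fderiv_prodMk {f : G × ℝ → ℝ} {z : G} {u : ℝ}
    (hf : ContDiffAt ℝ 1 f (z, u)) : ContinuousAt (fun u => fderiv ℝ f (z, u)) u :=
  (hf.fderiv_right (m := 0) (by norm_num)).continuousAt.comp (f := (z, ·)) (by fun_prop)

lemma exists_norm_fderiv_le_near {f : G × ℝ → ℝ} {z : G} {a b : ℝ}
    (hf : ∀ u ∈ Set.Icc a b, ContDiffAt ℝ 1 f (z, u)) :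
    ∃ M, ∀ᶠ x in nhds z, ∀ u ∈ Set.Icc a b,
      ContDiffAt ℝ 1 f (x, u) ∧ ‖fderiv ℝ f (x, u)‖ ≤ M := by
  obtain ⟨M, hM⟩ := (isCompact_Icc.image_of_continuousOn fun u hu =>
    (continuousAt_fderiv_prodMk (hf u hu)).norm.continuousWithinAt).bddAbove
  refine ⟨M + 1, isCompact_Icc.eventually_forall_of_forall_eventually fun u hu => ?_⟩
  have h_lt : ‖fderiv ℝ f (z, u)‖ < M + 1 := by linarith [hM (Set.mem_image_of_mem _ hu)]
  have h_cont := ((hf u hu).fderiv_right (m := 0) (by norm_num)).continuousAt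
  exact ((hf u hu).eventually (by norm_num)).and
    ((h_cont.norm.eventually_lt_const h_lt).mono fun _ => le_of_lt)

lemma intervalIntegrable_fderiv_prodMk {f : G × ℝ → ℝ} {z : G} {a b : ℝ} (hab : a ≤ b)
    (hf : ∀ u ∈ Set.Icc a b, ContDiffAt ℝ 1 f (z, u)) :
    IntervalIntegrable (fun u => fderiv ℝ f (z, u) ∘L .inl ℝ G ℝ) volume a b := by
  refine ContinuousOn.intervalIntegrable fun u hu => ?_
  rw [Set.uIcc_of_le hab] at hu
  exact ((continuousAt_fderiv_prodMk (hf u hu)).clm_comp continuousAt_const).continuousWithinAt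

lemma intervalIntegrable_comp_prodMk {f : G × ℝ → ℝ} {z : G} {a b : ℝ} (hab : a ≤ b)
    (hf : ∀ u ∈ Set.Icc a b, ContDiffAt ℝ 1 f (z, u)) :
    IntervalIntegrable (fun u => f (z, u)) volume a b := by
  refine ContinuousOn.intervalIntegrable fun u hu => ?_
  rw [Set.uIcc_of_le hab] at hu
  exact ((hf u hu).continuousAt.comp (f := (z, ·)) (by fun_prop)).continuousWithinAt

lemma hasFDerivAt_intervalIntegral_of_contDiffAt {f : G × ℝ → ℝ} {z : G} {a b : ℝ} (hab : a ≤ b)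
    (hf : ∀ u ∈ Set.Icc a b, ContDiffAt ℝ 1 f (z, u)) :
    HasFDerivAt (fun x => ∫ u in a..b, f (x, u))
      (∫ u in a..b, fderiv ℝ f (z, u) ∘L .inl ℝ G ℝ) z := by
  obtain ⟨M, hM⟩ := exists_norm_fderiv_le_near hf
  have h_sub : ∀ u ∈ Set.uIoc a b, u ∈ Set.Icc a b := fun u hu =>
    Set.Ioc_subset_Icc_self (Set.uIoc_of_le hab ▸ hu)
  refine hasFDerivAt_integral_of_dominated_of_fderiv_le
    (F := fun x u => f (x, u)) (F' := fun x u => fderiv ℝ f (x, u) ∘L .inl ℝ G ℝ)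
    (bound := fun _ => M) hM ?_ (intervalIntegrable_comp_prodMk hab hf)
    (intervalIntegrable_fderiv_prodMk hab hf).def'.aestronglyMeasurable
    (.of_forall fun u hu x hx => ?_) intervalIntegrable_const
    (.of_forall fun u hu x hx =>
      hasFDerivAt_comp_prodMk ((hx u (h_sub u hu)).1.differentiableAt one_ne_zero))
  · filter_upwards [hM] with x hx
    exact (intervalIntegrable_comp_prodMk hab fun u hu => (hx u hu).1).def'.aestronglyMeasurable
  · calc ‖fderiv ℝ f (x, u) ∘L .inl ℝ G ℝ‖
        ≤ ‖fderiv ℝ f (x, u)‖ * ‖ContinuousLinearMap.inl ℝ G ℝ‖ :=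
          ContinuousLinearMap.opNorm_comp_le _ _
      _ ≤ ‖fderiv ℝ f (x, u)‖ :=
          mul_le_of_le_one_right (norm_nonneg _) (ContinuousLinearMap.norm_inl_le_one ℝ G ℝ)
      _ ≤ M := (hx u (h_sub u hu)).2

/-- The derivative of the integral in the direction `v` is the integral of the total derivative of
`P`, and hence vanishes. -/
lemma isInvariantAt_intervalIntegral {f : G × ℝ → ℝ} {z v : G} {a b : ℝ} (hab : a ≤ b)
    (hf : ∀ u ∈ Set.Icc a b, ContDiffAt ℝ 1 f (z, u)) {P : ℝ → ℝ}
    (hP : ∀ u ∈ Set.Icc a b, HasDerivAt P (fderiv ℝ (fun x => f (x, u)) z v) u)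
    (hPab : P a = P b) : IsInvariantAt (fun x => ∫ u in a..b, f (x, u)) z v := by
  have h_int := intervalIntegrable_fderiv_prodMk hab hf
  refine .of_hasFDerivAt (hasFDerivAt_intervalIntegral_of_contDiffAt hab hf) ?_
  have h_deriv : ∀ u ∈ Set.uIcc a b,
      HasDerivAt P ((fderiv ℝ f (z, u) ∘L .inl ℝ G ℝ) v) u := fun u hu => by
    rw [Set.uIcc_of_le hab] at hu
    rw [← (hasFDerivAt_comp_prodMk ((hf u hu).differentiableAt one_ne_zero)).fderiv]
    exact hP u hu
  rw [ContinuousLinearMap.intervalIntegral_apply h_int, integral_eq_sub_of_hasDerivAt h_deriv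
    ⟨h_int.1.apply_continuousLinearMap v, h_int.2.apply_continuousLinearMap v⟩, hPab, sub_self]

lemma hasDerivAt_norm_comp {E : Type*} [NormedAddCommGroup E] [InnerProductSpace ℝ E] {y : ℝ → E}
    {y' : E} {t : ℝ} (hy : HasDerivAt y y' t) (h_ne : y t ≠ 0) :
    HasDerivAt (fun s => ‖y s‖) (inner ℝ (y t) y' / ‖y t‖) t := by
  have h := hy.norm_sq.sqrt (by positivity)
  simp only [Real.sqrt_sq (norm_nonneg _)] at h
  refine h.congr_deriv ?_
  field_simp

end Calculus

section LinearAlgebra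

variable {E : Type*} [NormedAddCommGroup E] [InnerProductSpace ℝ E]

/-- The linear map that scales the direction of the unit vector `e` by `c` and fixes its
orthogonal complement. -/
def axisScale (c : ℝ) (e : E) : E →L[ℝ] E :=
  .id ℝ E + (c - 1) • InnerProductSpace.rankOne ℝ e e

/-- The component orthogonal to the unit vector `e`. -/
def perp (e : E) : E →L[ℝ] E := axisScale 0 e

/-- The bivector `x ∧ y` as an infinitesimal rotation. -/
def wedge (x y : E) : E →L[ℝ] E :=
  InnerProductSpace.rankOne ℝ x y - InnerProductSpace.rankOne ℝ y x

lemma axisScale_apply (c : ℝ) (e v : E) :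
    axisScale c e v = v + ((c - 1) * inner ℝ v e) • e := by
  simp [axisScale, mul_smul, real_inner_comm v e]

lemma axisScale_one (e v : E) : axisScale 1 e v = v := by
  simp [axisScale_apply]

lemma inner_axisScale_left (c : ℝ) (e v v' : E) :
    inner ℝ (axisScale c e v) v' = inner ℝ v (axisScale c e v') := by
  simp only [axisScale_apply, inner_add_left, inner_add_right, real_inner_smul_left,
    real_inner_smul_right, real_inner_comm v' e]
  ring

lemma axisScale_axisScale {e : E} (he : ‖e‖ = 1) (c c' : ℝ) (v : E) :
    axisScale c e (axisScale c' e v) = axisScale (c * c') e v := by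
  simp only [axisScale_apply, inner_add_left, real_inner_smul_left, real_inner_self_eq_norm_sq, he]
  module

lemma axisScale_self {e : E} (he : ‖e‖ = 1) (c : ℝ) : axisScale c e e = c • e := by
  rw [axisScale_apply, real_inner_self_eq_norm_sq, he]
  module

lemma inner_axisScale_axis {e : E} (he : ‖e‖ = 1) (c : ℝ) (v : E) :
    inner ℝ (axisScale c e v) e = c * inner ℝ v e := by
  rw [inner_axisScale_left, axisScale_self he, real_inner_smul_right]

lemma inner_axisScale {e : E} (he : ‖e‖ = 1) (c : ℝ) (v v' : E) :
    inner ℝ (axisScale c e v) (axisScale c e v') =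
      inner ℝ v v' + (c ^ 2 - 1) * (inner ℝ v e * inner ℝ v' e) := by
  rw [inner_axisScale_left, axisScale_axisScale he, axisScale_apply, inner_add_right,
    real_inner_smul_right]
  ring

lemma norm_axisScale_sq {e : E} (he : ‖e‖ = 1) (c : ℝ) (v : E) :
    ‖axisScale c e v‖ ^ 2 = ‖v‖ ^ 2 + (c ^ 2 - 1) * inner ℝ v e ^ 2 := by
  rw [← real_inner_self_eq_norm_sq, inner_axisScale he, real_inner_self_eq_norm_sq,
    sq (inner ℝ v e)]

lemma perp_apply (e y : E) : perp e y = y - inner ℝ y e • e := by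
  rw [perp, axisScale_apply]
  module

lemma inner_perp_perp {e : E} (he : ‖e‖ = 1) (y w : E) :
    inner ℝ (perp e y) (perp e w) = inner ℝ y w - inner ℝ y e * inner ℝ w e := by
  rw [perp, inner_axisScale he]
  ring

lemma wedge_apply (x y v : E) : wedge x y v = inner ℝ y v • x - inner ℝ x v • y := by
  simp [wedge]

lemma wedge_linearCombination (x y : E) (α β γ δ : ℝ) :
    wedge (α • x + β • y) (γ • x + δ • y) = (α * δ - β * γ) • wedge x y := by
  ext v
  simp only [wedge_apply, smul_apply, inner_add_left, real_inner_smul_left]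
  module

lemma wedge_smul_right (c : ℝ) (x y : E) : wedge x (c • y) = c • wedge x y := by
  simpa using wedge_linearCombination x y 1 0 0 c

lemma norm_add_smul_sq (x y : E) (α β : ℝ) :
    ‖α • x + β • y‖ ^ 2 = α ^ 2 * ‖x‖ ^ 2 + 2 * α * β * inner ℝ x y + β ^ 2 * ‖y‖ ^ 2 := by
  rw [norm_add_sq_real, real_inner_smul_left, real_inner_smul_right, norm_smul, norm_smul, mul_pow,
    mul_pow, Real.norm_eq_abs, Real.norm_eq_abs, sq_abs, sq_abs]
  ring

end LinearAlgebra

/-! ### Kepler ellipses and their eccentric anomaly -/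

section Ellipse

variable {E : Type*} [NormedAddCommGroup E] [InnerProductSpace ℝ E]

/-- The major semi-axis of the ellipse with a focus at `0` that passes through `y` with velocity
`η` with respect to the eccentric anomaly. -/
def semiMajorAxis (y η : E) : ℝ := (‖y‖ ^ 2 + ‖η‖ ^ 2) / (2 * ‖y‖)

/-- The center of the ellipse of `semiMajorAxis`. -/
def ellipseCenter (y η : E) : E :=
  (1 - semiMajorAxis y η / ‖y‖) • y + (inner ℝ y η / ‖y‖ ^ 2) • η

/-- The ellipse with a focus at `0` that passes through `y` with velocity `η`, parametrized by the
eccentric anomaly `u`, which is counted from `y`. -/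
def ellipse (y η : E) (u : ℝ) : E :=
  Real.cos u • y + Real.sin u • η + (1 - Real.cos u) • ellipseCenter y η

/-- The derivative of `ellipse` with respect to the eccentric anomaly. -/
def ellipseVel (y η : E) (u : ℝ) : E :=
  Real.cos u • η + Real.sin u • (ellipseCenter y η - y)

/-- The distance of the points of `ellipse` from the focus. It is given by a formula that is
smooth in `u` and has the wrong sign where the degenerate ellipse has passed through the focus. -/
def focalRadius (y η : E) (u : ℝ) : ℝ :=
  Real.cos u * ‖y‖ + Real.sin u * (inner ℝ y η / ‖y‖) + (1 - Real.cos u) * semiMajorAxis y η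

/-- The derivative of `focalRadius` with respect to the eccentric anomaly. -/
def focalRadiusVel (y η : E) (u : ℝ) : ℝ :=
  Real.cos u * (inner ℝ y η / ‖y‖) + Real.sin u * (semiMajorAxis y η - ‖y‖)

variable {y η : E}

lemma ellipse_zero : ellipse y η 0 = y := by simp [ellipse]

lemma ellipseVel_zero : ellipseVel y η 0 = η := by simp [ellipseVel]

lemma focalRadius_zero : focalRadius y η 0 = ‖y‖ := by simp [focalRadius]

lemma ellipse_periodic (y η : E) : Function.Periodic (ellipse y η) (2 * Real.pi) := fun u => by
  simp [ellipse]

lemma hasDerivAt_ellipse (y η : E) (u : ℝ) : HasDerivAt (ellipse y η) (ellipseVel y η u) u := by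
  refine ((((Real.hasDerivAt_cos u).smul_const y).add
    ((Real.hasDerivAt_sin u).smul_const η)).add
    (((Real.hasDerivAt_cos u).const_sub 1).smul_const (ellipseCenter y η))).congr_deriv ?_
  rw [ellipseVel]
  module

lemma hasDerivAt_ellipseVel (y η : E) (u : ℝ) :
    HasDerivAt (ellipseVel y η) (ellipseCenter y η - ellipse y η u) u := by
  refine (((Real.hasDerivAt_cos u).smul_const η).add
    ((Real.hasDerivAt_sin u).smul_const (ellipseCenter y η - y))).congr_deriv ?_
  rw [ellipse]
  module

lemma hasDerivAt_focalRadius (y η : E) (u : ℝ) :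
    HasDerivAt (focalRadius y η) (focalRadiusVel y η u) u := by
  refine ((((Real.hasDerivAt_cos u).mul_const ‖y‖).add
    ((Real.hasDerivAt_sin u).mul_const (inner ℝ y η / ‖y‖))).add
    (((Real.hasDerivAt_cos u).const_sub 1).mul_const (semiMajorAxis y η))).congr_deriv ?_
  rw [focalRadiusVel]
  ring

lemma continuous_ellipse (y η : E) : Continuous (ellipse y η) :=
  continuous_iff_continuousAt.2 fun u => (hasDerivAt_ellipse y η u).continuousAt

lemma continuous_focalRadius (y η : E) : Continuous (focalRadius y η) :=
  continuous_iff_continuousAt.2 fun u => (hasDerivAt_focalRadius y η u).continuousAt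

lemma ellipse_eq_smul_add_smul (y η : E) (u : ℝ) : ellipse y η u =
    (1 - (1 - Real.cos u) * (semiMajorAxis y η / ‖y‖)) • y +
      (Real.sin u + (1 - Real.cos u) * (inner ℝ y η / ‖y‖ ^ 2)) • η := by
  simp only [ellipse, ellipseCenter]
  module

lemma ellipseVel_eq_smul_add_smul (y η : E) (u : ℝ) : ellipseVel y η u =
    (-(Real.sin u * (semiMajorAxis y η / ‖y‖))) • y +
      (Real.cos u + Real.sin u * (inner ℝ y η / ‖y‖ ^ 2)) • η := by
  simp only [ellipseVel, ellipseCenter]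
  module

omit [InnerProductSpace ℝ E] in
lemma norm_sq_eq_semiMajorAxis {y : E} (hy : y ≠ 0) (η : E) :
    ‖η‖ ^ 2 = 2 * semiMajorAxis y η * ‖y‖ - ‖y‖ ^ 2 := by
  have hr := norm_ne_zero_iff.2 hy
  rw [semiMajorAxis]
  field_simp
  ring

lemma norm_ellipse_sq (hy : y ≠ 0) (η : E) (u : ℝ) :
    ‖ellipse y η u‖ ^ 2 = focalRadius y η u ^ 2 := by
  have hr := norm_ne_zero_iff.2 hy
  have hsin : Real.sin u ^ 2 = 1 - Real.cos u ^ 2 := Real.sin_sq u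
  rw [ellipse_eq_smul_add_smul, norm_add_smul_sq, norm_sq_eq_semiMajorAxis hy η, focalRadius]
  field_simp
  ring_nf
  simp only [hsin]
  ring

lemma inner_ellipse_ellipseVel (hy : y ≠ 0) (η : E) (u : ℝ) :
    inner ℝ (ellipse y η u) (ellipseVel y η u) = focalRadius y η u * focalRadiusVel y η u := by
  have h_norm : HasDerivAt (fun u => ‖ellipse y η u‖ ^ 2) _ u := (hasDerivAt_ellipse y η u).norm_sq
  have h_radius : HasDerivAt (fun u => focalRadius y η u ^ 2) _ u :=
    (hasDerivAt_focalRadius y η u).pow 2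
  simp only [norm_ellipse_sq hy η] at h_norm
  linear_combination h_norm.unique h_radius / 2

lemma wedge_map_ellipse {F : Type*} [NormedAddCommGroup F] [InnerProductSpace ℝ F] (hy : y ≠ 0)
    (η : E) (L : E →L[ℝ] F) (u : ℝ) :
    wedge (L (ellipse y η u)) (L (ellipseVel y η u)) =
      (focalRadius y η u / ‖y‖) • wedge (L y) (L η) := by
  have hr := norm_ne_zero_iff.2 hy
  simp only [ellipse_eq_smul_add_smul, ellipseVel_eq_smul_add_smul, map_add, map_smul,
    wedge_linearCombination]
  congr 1
  rw [focalRadius]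
  field_simp
  linear_combination (semiMajorAxis y η * ‖y‖ ^ 2) * Real.sin_sq_add_cos_sq u

lemma focalRadius_pos (hy : y ≠ 0) (h : ∀ u, ellipse y η u ≠ 0) (u : ℝ) :
    0 < focalRadius y η u := by
  have h_ne : ∀ u, focalRadius y η u ≠ 0 := fun u hu => h u <| by
    simpa [hu] using norm_ellipse_sq hy η u
  by_contra! hu
  obtain ⟨v, -, hv⟩ := intermediate_value_uIcc (continuous_focalRadius y η).continuousOn
    (show (0 : ℝ) ∈ Set.uIcc (focalRadius y η u) (focalRadius y η 0) from
      Set.mem_uIcc.2 (Or.inl ⟨hu, by rw [focalRadius_zero]; positivity⟩))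
  exact h_ne v hv

lemma norm_ellipse (hy : y ≠ 0) (h : ∀ u, ellipse y η u ≠ 0) (u : ℝ) :
    ‖ellipse y η u‖ = focalRadius y η u :=
  (sq_eq_sq₀ (norm_nonneg _) (focalRadius_pos hy h u).le).1 (norm_ellipse_sq hy η u)

/-- Kepler's equation of motion in the eccentric anomaly, where `ellipseCenter - ellipse` is the
second derivative of `ellipse`. -/
lemma ellipse_newton (hy : y ≠ 0) (η : E) (u : ℝ) :
    focalRadius y η u • (ellipseCenter y η - ellipse y η u) -
        focalRadiusVel y η u • ellipseVel y η u = -(semiMajorAxis y η) • ellipse y η u := by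
  have hr := norm_ne_zero_iff.2 hy
  have h_trig := Real.sin_sq_add_cos_sq u
  rw [ellipse_eq_smul_add_smul, ellipseVel_eq_smul_add_smul, ellipseCenter, focalRadius,
    focalRadiusVel]
  match_scalars
  · field_simp
    linear_combination (‖y‖ * semiMajorAxis y η ^ 2 - ‖y‖ ^ 2 * semiMajorAxis y η) * h_trig
  · field_simp
    linear_combination (-(‖y‖ * semiMajorAxis y η * inner ℝ y η)) * h_trig

end Ellipse

/-! ### The Hamiltonian field of `D` in the normalized chart -/

section Field

variable {E : Type*} [NormedAddCommGroup E] [InnerProductSpace ℝ E]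

/-- The function `D` in the normalized chart, whose origin is the first center, in which the second
center is `2 h e`, and whose scalar product is that of `‖·‖_a`. -/
def chartD (μ h : ℝ) (e : E) (z : E × E) : ℝ :=
  ‖z.1‖ ^ 2 * ‖z.2‖ ^ 2 - inner ℝ z.1 z.2 ^ 2 -
    2 * h * (‖z.2‖ ^ 2 * inner ℝ z.1 e - inner ℝ z.1 z.2 * inner ℝ z.2 e -
      μ * inner ℝ z.1 e / ‖z.1‖)

/-- The gradient of `chartD` with respect to the position. -/
def gradPos (μ h : ℝ) (e : E) (z : E × E) : E :=
  (2 * ‖z.2‖ ^ 2 - 2 * h * μ * inner ℝ z.1 e / ‖z.1‖ ^ 3) • z.1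
    + (2 * h * inner ℝ z.2 e - 2 * inner ℝ z.1 z.2) • z.2
    + (2 * h * (μ / ‖z.1‖ - ‖z.2‖ ^ 2)) • e

/-- The gradient of `chartD` with respect to the velocity. -/
def gradVel (h : ℝ) (e : E) (z : E × E) : E :=
  (2 * ‖z.1‖ ^ 2 - 4 * h * inner ℝ z.1 e) • z.2
    + (2 * h * inner ℝ z.2 e - 2 * inner ℝ z.1 z.2) • z.1
    + (2 * h * inner ℝ z.1 z.2) • e

/-- The symmetric operator that turns covectors of the hyperbolic metric at the point of the
normalized chart with position `p` relative to the midpoint of the centers into vectors, up to a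
conformal factor. -/
def chartCometric (h : ℝ) (e p x : E) : E :=
  x + (h ^ 2 * inner ℝ x e) • e - (inner ℝ p x : ℝ) • p

/-- The Hamiltonian vector field of `chartD` for the Poisson bracket of `Tℍ^d`. -/
def hamField (μ h : ℝ) (e : E) (z : E × E) : E × E :=
  (chartCometric h e (z.1 - h • e) (gradVel h e z),
    -chartCometric h e (z.1 - h • e) (gradPos μ h e z)
      - (inner ℝ (gradVel h e z) z.2 : ℝ) • (z.1 - h • e)
      + (inner ℝ (z.1 - h • e) (gradVel h e z) : ℝ) • z.2)

/-- Minus twice the Kepler energy. On a bounded orbit it is the square of the frequency of the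
eccentric anomaly with respect to the fictitious time `∫ dτ / ‖y‖`. -/
def freqSq (μ : ℝ) (z : E × E) : ℝ := 2 * μ / ‖z.1‖ - ‖z.2‖ ^ 2

/-- The infinitesimal rotation that moves the orbits along `hamField`. -/
def orbitRotation (h : ℝ) (e y w : E) : E →L[ℝ] E :=
  (-2 : ℝ) • wedge y w + (2 * h ^ 2) • wedge (perp e y) (perp e w)

/-- The shift of the time `τ` between the motion of the orbits along `hamField` and that by
`orbitRotation` and a stretching along the axis. -/
def timeShift (h : ℝ) (e y : E) : ℝ :=
  2 * h * inner ℝ y e + 2 * h ^ 2 * (inner ℝ y e ^ 2 - ‖y‖ ^ 2)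

variable {e y : E}

lemma hamField_fst (he : ‖e‖ = 1) (μ h : ℝ) (y w : E) : (hamField μ h e (y, w)).1 =
    (2 * ‖y‖ ^ 2 - 4 * h * inner ℝ y e) • w
      + (2 * h * inner ℝ w e - 2 * inner ℝ y w
          + 2 * h ^ 2 * (inner ℝ y w - inner ℝ y e * inner ℝ w e)) • y
      + (2 * h * inner ℝ y w
          + 2 * h ^ 2 * (‖y‖ ^ 2 * inner ℝ w e - inner ℝ y e * inner ℝ y w)) • e := by
  simp only [hamField, chartCometric, gradVel, inner_add_left, inner_add_right, inner_sub_left,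
    real_inner_smul_left, real_inner_smul_right, real_inner_comm y e, real_inner_comm w e,
    real_inner_self_eq_norm_sq, he]
  module

lemma hamField_snd (he : ‖e‖ = 1) (hy : y ≠ 0) (μ h : ℝ) (w : E) : (hamField μ h e (y, w)).2 =
    (2 * inner ℝ y w - 2 * h * inner ℝ w e
        + 2 * h ^ 2 * (inner ℝ y e * inner ℝ w e - inner ℝ y w)) • w
      + (-2 * ‖w‖ ^ 2 + 2 * h * μ * inner ℝ y e / ‖y‖ ^ 3
        + 2 * h ^ 2 * (‖w‖ ^ 2 - μ / ‖y‖ - inner ℝ w e ^ 2 + μ * inner ℝ y e ^ 2 / ‖y‖ ^ 3)) • y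
      + (2 * h * (‖w‖ ^ 2 - μ / ‖y‖)
        + 2 * h ^ 2 * (inner ℝ w e * inner ℝ y w - ‖w‖ ^ 2 * inner ℝ y e)) • e := by
  have hr := norm_ne_zero_iff.2 hy
  simp only [hamField, chartCometric, gradVel, gradPos, inner_add_left, inner_add_right,
    inner_sub_left, real_inner_smul_left, real_inner_smul_right, real_inner_comm y e,
    real_inner_comm w e, real_inner_self_eq_norm_sq, he]
  match_scalars <;> field_simp <;> ring

lemma hamField_fst_eq_orbitRotation (he : ‖e‖ = 1) (μ h : ℝ) (y w : E) :
    (hamField μ h e (y, w)).1 = orbitRotation h e y w y + (2 * h * inner ℝ y w) • e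
      + (2 * h) • wedge y w e - timeShift h e y • w := by
  simp only [hamField_fst he, orbitRotation, timeShift, add_apply, smul_apply, wedge_apply,
    perp_apply, inner_sub_left, real_inner_smul_left, real_inner_comm y e, real_inner_comm y w,
    real_inner_self_eq_norm_sq]
  module

lemma inner_hamField_fst (he : ‖e‖ = 1) (μ h : ℝ) (y w : E) :
    inner ℝ y (hamField μ h e (y, w)).1 =
      2 * h * (1 + h * inner ℝ y e) * (‖y‖ ^ 2 * inner ℝ w e - inner ℝ y e * inner ℝ y w)
        + 2 * h ^ 2 * ‖y‖ ^ 2 * (inner ℝ y w - inner ℝ y e * inner ℝ w e) := by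
  simp only [hamField_fst he, inner_add_right, real_inner_smul_right, real_inner_self_eq_norm_sq]
  ring

end Field

/-! ### Variation of the Kepler orbits along the Hamiltonian field of `D` -/

section Variation

variable {E : Type*} [NormedAddCommGroup E] [InnerProductSpace ℝ E]

/-- The initial velocity of the Kepler orbit with initial data `z` with respect to the eccentric
anomaly. -/
def anomVel (μ : ℝ) (z : E × E) : E := (‖z.1‖ / √(freqSq μ z)) • z.2

/-- The Kepler orbit with initial data `z`, parametrized by the eccentric anomaly. -/
def orbit (μ : ℝ) (z : E × E) : ℝ → E := ellipse z.1 (anomVel μ z)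

/-- The derivative of `orbit` with respect to the eccentric anomaly. -/
def orbitVel (μ : ℝ) (z : E × E) : ℝ → E := ellipseVel z.1 (anomVel μ z)

/-- The displacement of an orbit along `hamField` at a point `y` that it passes with velocity `v`,
up to a shift of the eccentric anomaly and a constant factor. -/
def orbitShift (h : ℝ) (e y v : E) : E :=
  ‖y‖⁻¹ • (orbitRotation h e y v y + (2 * h) • wedge y v e + (2 * h * inner ℝ y v) • e)

variable {μ : ℝ} {z : E × E}

lemma hasDerivAt_orbit (μ : ℝ) (z : E × E) (u : ℝ) :
    HasDerivAt (orbit μ z) (orbitVel μ z u) u :=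
  hasDerivAt_ellipse _ _ u

lemma fst_ne_zero_of_orbit_ne_zero (hz : ∀ u, orbit μ z u ≠ 0) : z.1 ≠ 0 := by
  simpa [orbit, ellipse_zero] using hz 0

lemma semiMajorAxis_anomVel (hy : z.1 ≠ 0) (hf : 0 < freqSq μ z) :
    semiMajorAxis z.1 (anomVel μ z) = μ / freqSq μ z := by
  have hr := norm_ne_zero_iff.2 hy
  have h_speed : ‖z.2‖ ^ 2 = 2 * μ / ‖z.1‖ - freqSq μ z := by rw [freqSq]; ring
  rw [semiMajorAxis, anomVel, norm_smul, Real.norm_eq_abs, mul_pow, sq_abs, div_pow,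
    Real.sq_sqrt hf.le, h_speed]
  field_simp
  ring

lemma ellipseCenter_anomVel (hy : z.1 ≠ 0) (hf : 0 < freqSq μ z) :
    ellipseCenter z.1 (anomVel μ z) = (freqSq μ z)⁻¹ •
      (inner ℝ z.1 z.2 • z.2 - (‖z.2‖ ^ 2 - μ / ‖z.1‖) • z.1) := by
  have hr := norm_ne_zero_iff.2 hy
  have h_sqrt := (Real.sqrt_pos.2 hf).ne'
  have h_speed : ‖z.2‖ ^ 2 = 2 * μ / ‖z.1‖ - freqSq μ z := by rw [freqSq]; ring
  rw [ellipseCenter, semiMajorAxis_anomVel hy hf, anomVel, real_inner_smul_right, h_speed]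
  match_scalars
  · field_simp
    ring
  · field_simp
    rw [Real.sq_sqrt hf.le, mul_comm]

section Smoothness

lemma contDiffAt_norm_fst (hy : z.1 ≠ 0) : ContDiffAt ℝ 1 (fun z : E × E => ‖z.1‖) z :=
  contDiffAt_fst.norm ℝ hy

lemma contDiffAt_freqSq (μ : ℝ) (hy : z.1 ≠ 0) : ContDiffAt ℝ 1 (freqSq μ) z :=
  (contDiffAt_const.div (contDiffAt_norm_fst hy) (norm_ne_zero_iff.2 hy)).sub
    (contDiffAt_snd.norm_sq ℝ)

lemma contDiffAt_anomVel (hy : z.1 ≠ 0) (hf : 0 < freqSq μ z) : ContDiffAt ℝ 1 (anomVel μ) z :=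
  ((contDiffAt_norm_fst hy).div ((contDiffAt_freqSq μ hy).sqrt hf.ne')
    (Real.sqrt_pos.2 hf).ne').smul contDiffAt_snd

lemma contDiffAt_ellipseCenter (hy : z.1 ≠ 0) :
    ContDiffAt ℝ 1 (fun z : E × E => ellipseCenter z.1 z.2) z := by
  have hr := norm_ne_zero_iff.2 hy
  have h_norm := contDiffAt_norm_fst hy
  have h_axis : ContDiffAt ℝ 1 (fun z : E × E => semiMajorAxis z.1 z.2) z :=
    ((h_norm.pow 2).add (contDiffAt_snd.norm_sq ℝ)).div (contDiffAt_const.mul h_norm) (by simpa)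
  exact ((contDiffAt_const.sub (h_axis.div h_norm hr)).smul contDiffAt_fst).add
    (((contDiffAt_fst.inner ℝ contDiffAt_snd).div (h_norm.pow 2) (pow_ne_zero 2 hr)).smul
      contDiffAt_snd)

lemma contDiffAt_orbit (hy : z.1 ≠ 0) (hf : 0 < freqSq μ z) (u : ℝ) :
    ContDiffAt ℝ 1 (fun p : (E × E) × ℝ => orbit μ p.1 p.2) (z, u) := by
  have h_pos : ContDiffAt ℝ 1 (fun p : (E × E) × ℝ => p.1.1) (z, u) := by fun_prop
  have h_vel : ContDiffAt ℝ 1 (fun p : (E × E) × ℝ => anomVel μ p.1) (z, u) :=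
    (contDiffAt_anomVel hy hf).comp (f := Prod.fst) (z, u) contDiffAt_fst
  have h_center : ContDiffAt ℝ 1
      (fun p : (E × E) × ℝ => ellipseCenter p.1.1 (anomVel μ p.1)) (z, u) :=
    (contDiffAt_ellipseCenter (z := (z.1, anomVel μ z)) hy).comp
      (f := fun p : (E × E) × ℝ => (p.1.1, anomVel μ p.1)) (z, u) (h_pos.prodMk h_vel)
  have h_cos : ContDiffAt ℝ 1 (fun p : (E × E) × ℝ => Real.cos p.2) (z, u) := by fun_prop
  have h_sin : ContDiffAt ℝ 1 (fun p : (E × E) × ℝ => Real.sin p.2) (z, u) := by fun_prop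
  exact ((h_cos.smul h_pos).add (h_sin.smul h_vel)).add
    ((contDiffAt_const.sub h_cos).smul h_center)

end Smoothness

section OrbitShift

variable {e : E} {h : ℝ}

lemma norm_orbit (hz : ∀ u, orbit μ z u ≠ 0) (u : ℝ) :
    ‖orbit μ z u‖ = focalRadius z.1 (anomVel μ z) u :=
  norm_ellipse (fst_ne_zero_of_orbit_ne_zero hz) hz u

lemma inner_orbit_orbitVel (hz : ∀ u, orbit μ z u ≠ 0) (u : ℝ) :
    inner ℝ (orbit μ z u) (orbitVel μ z u) =
      ‖orbit μ z u‖ * focalRadiusVel z.1 (anomVel μ z) u := by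
  rw [norm_orbit hz]
  exact inner_ellipse_ellipseVel (fst_ne_zero_of_orbit_ne_zero hz) _ u

lemma wedge_map_orbit (hf : 0 < freqSq μ z) (hz : ∀ u, orbit μ z u ≠ 0) (L : E →L[ℝ] E) (u : ℝ) :
    √(freqSq μ z) • wedge (L (orbit μ z u)) (L (orbitVel μ z u)) =
      ‖orbit μ z u‖ • wedge (L z.1) (L z.2) := by
  have hy := fst_ne_zero_of_orbit_ne_zero hz
  have hr := norm_ne_zero_iff.2 hy
  have h_sqrt := (Real.sqrt_pos.2 hf).ne'
  rw [norm_orbit hz, orbit, orbitVel, wedge_map_ellipse hy, anomVel, map_smul, wedge_smul_right,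
    smul_smul, smul_smul]
  congr 1
  field_simp

lemma smul_orbitRotation_orbit (h : ℝ) (e : E) (hf : 0 < freqSq μ z) (hz : ∀ u, orbit μ z u ≠ 0)
    (u : ℝ) : √(freqSq μ z) • orbitRotation h e (orbit μ z u) (orbitVel μ z u) =
      ‖orbit μ z u‖ • orbitRotation h e z.1 z.2 := by
  have h_wedge := wedge_map_orbit hf hz (.id ℝ E) u
  rw [orbitRotation, orbitRotation, smul_add, smul_comm _ (-2 : ℝ), smul_comm _ (2 * h ^ 2),
    wedge_map_orbit hf hz]
  simp only [ContinuousLinearMap.id_apply] at h_wedge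
  rw [h_wedge]
  module

lemma smul_orbitShift_orbit (h : ℝ) (e : E) (hf : 0 < freqSq μ z) (hz : ∀ u, orbit μ z u ≠ 0)
    (u : ℝ) : √(freqSq μ z) • orbitShift h e (orbit μ z u) (orbitVel μ z u) =
      orbitRotation h e z.1 z.2 (orbit μ z u) + (2 * h) • wedge z.1 z.2 e
        + (2 * h * √(freqSq μ z) * focalRadiusVel z.1 (anomVel μ z) u) • e := by
  have hr := norm_ne_zero_iff.2 (hz u)
  have h_rot := congr($(smul_orbitRotation_orbit h e hf hz u) (orbit μ z u))
  have h_wedge := congr($(wedge_map_orbit hf hz (.id ℝ E) u) e)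
  simp only [smul_apply, ContinuousLinearMap.id_apply] at h_rot h_wedge
  rw [orbitShift, inner_orbit_orbitVel hz, smul_comm, smul_add, smul_add, smul_add, h_rot,
    smul_comm _ (2 * h), h_wedge]
  match_scalars <;> field_simp

end OrbitShift

section AlongField

variable {e : E} {h t : ℝ} {y w : ℝ → E}

lemma hasDerivAt_freqSq (he : ‖e‖ = 1) (hy : HasDerivAt y (hamField μ h e (y t, w t)).1 t)
    (hw : HasDerivAt w (hamField μ h e (y t, w t)).2 t) (h_ne : y t ≠ 0) :
    HasDerivAt (fun s => freqSq μ (y s, w s)) 0 t := by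
  have hr := norm_ne_zero_iff.2 h_ne
  refine (((hasDerivAt_const t (2 * μ)).fun_div (hasDerivAt_norm_comp hy h_ne) hr).fun_sub
    hw.norm_sq).congr_deriv ?_
  simp only [inner_hamField_fst he, hamField_snd he h_ne, inner_add_right, real_inner_smul_right,
    real_inner_self_eq_norm_sq, real_inner_comm (y t) (w t)]
  field_simp
  ring

lemma hasDerivAt_anomVel (he : ‖e‖ = 1) (hy : HasDerivAt y (hamField μ h e (y t, w t)).1 t)
    (hw : HasDerivAt w (hamField μ h e (y t, w t)).2 t) (h_ne : y t ≠ 0)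
    (hf : 0 < freqSq μ (y t, w t)) :
    HasDerivAt (fun s => anomVel μ (y s, w s))
      (orbitRotation h e (y t) (w t) (anomVel μ (y t, w t))
        + (2 * h * √(freqSq μ (y t, w t)) *
            (semiMajorAxis (y t) (anomVel μ (y t, w t)) - ‖y t‖)) • e
        - (√(freqSq μ (y t, w t)) * timeShift h e (y t) / ‖y t‖) •
            (ellipseCenter (y t) (anomVel μ (y t, w t)) - y t)) t := by
  have hr := norm_ne_zero_iff.2 h_ne
  have h_sqrt := (Real.sqrt_pos.2 hf).ne'
  refine (((hasDerivAt_norm_comp hy h_ne).fun_div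
    ((hasDerivAt_freqSq he hy hw h_ne).sqrt hf.ne') h_sqrt).fun_smul hw).congr_deriv ?_
  have hμ : μ = ‖y t‖ * (√(freqSq μ (y t, w t)) ^ 2 + ‖w t‖ ^ 2) / 2 := by
    rw [Real.sq_sqrt hf.le, freqSq]
    field_simp
    ring
  simp only [anomVel, inner_hamField_fst he, hamField_snd he h_ne]
  generalize √(freqSq μ (y t, w t)) = ω at *
  simp only [orbitRotation, add_apply, smul_apply, timeShift, wedge_apply, perp_apply,
    inner_sub_left, real_inner_smul_left,
    real_inner_smul_right, ellipseCenter, semiMajorAxis, norm_smul, Real.norm_eq_abs, mul_pow,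
    sq_abs, real_inner_comm (w t) e, real_inner_self_eq_norm_sq, hμ]
  match_scalars <;> field_simp <;> ring

lemma hasDerivAt_ellipseCenter_anomVel (he : ‖e‖ = 1)
    (hy : HasDerivAt y (hamField μ h e (y t, w t)).1 t)
    (hw : HasDerivAt w (hamField μ h e (y t, w t)).2 t) (h_ne : y t ≠ 0)
    (hf : 0 < freqSq μ (y t, w t)) :
    HasDerivAt (fun s => ellipseCenter (y s) (anomVel μ (y s, w s)))
      (orbitRotation h e (y t) (w t) (ellipseCenter (y t) (anomVel μ (y t, w t)))
        + (2 * h) • wedge (y t) (w t) e) t := by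
  have hr := norm_ne_zero_iff.2 h_ne
  have hf' := hasDerivAt_freqSq he hy hw h_ne
  have h_near : ∀ᶠ s in nhds t, y s ≠ 0 ∧ 0 < freqSq μ (y s, w s) :=
    (hy.continuousAt.eventually_ne h_ne).and (hf'.continuousAt.eventually_const_lt hf)
  have h_div := (hasDerivAt_const t μ).fun_div (hasDerivAt_norm_comp hy h_ne) hr
  refine (((hf'.fun_inv hf.ne').fun_smul (((hy.inner ℝ hw).fun_smul hw).fun_sub
    ((hw.norm_sq.fun_sub h_div).fun_smul hy))).congr_of_eventuallyEq
      (h_near.mono fun s hs => ellipseCenter_anomVel hs.1 hs.2)).congr_deriv ?_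
  have hμ : μ = ‖y t‖ * (freqSq μ (y t, w t) + ‖w t‖ ^ 2) / 2 := by
    rw [freqSq]
    field_simp
    ring
  rw [ellipseCenter_anomVel h_ne hf]
  simp only [hamField_snd he h_ne, hamField_fst he]
  generalize freqSq μ (y t, w t) = f at *
  simp only [orbitRotation, add_apply, smul_apply, wedge_apply, perp_apply,
    inner_sub_left, inner_sub_right, inner_add_left, inner_add_right, real_inner_smul_left,
    real_inner_smul_right, real_inner_comm (y t) e, real_inner_comm (w t) e,
    real_inner_comm (y t) (w t), real_inner_self_eq_norm_sq, hμ]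
  match_scalars <;> field_simp <;> ring

lemma hasDerivAt_orbit_hamField (he : ‖e‖ = 1)
    (hy : HasDerivAt y (hamField μ h e (y t, w t)).1 t)
    (hw : HasDerivAt w (hamField μ h e (y t, w t)).2 t)
    (hf : 0 < freqSq μ (y t, w t)) (h_ne : ∀ u, orbit μ (y t, w t) u ≠ 0) (u : ℝ) :
    HasDerivAt (fun s => orbit μ (y s, w s) u)
      (√(freqSq μ (y t, w t)) •
          orbitShift h e (orbit μ (y t, w t) u) (orbitVel μ (y t, w t) u)
        - (√(freqSq μ (y t, w t)) * timeShift h e (y t) / ‖y t‖) • orbitVel μ (y t, w t) u) t := by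
  have hy0 := fst_ne_zero_of_orbit_ne_zero h_ne
  have hr := norm_ne_zero_iff.2 hy0
  have h_sqrt := (Real.sqrt_pos.2 hf).ne'
  refine (((hy.const_smul (Real.cos u)).fun_add
    ((hasDerivAt_anomVel he hy hw hy0 hf).const_smul (Real.sin u))).fun_add
    ((hasDerivAt_ellipseCenter_anomVel he hy hw hy0 hf).const_smul
      (1 - Real.cos u))).congr_deriv ?_
  have h_inner : inner ℝ (y t) (w t) =
      √(freqSq μ (y t, w t)) * (inner ℝ (y t) (anomVel μ (y t, w t)) / ‖y t‖) := by
    rw [anomVel, real_inner_smul_right]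
    field_simp
  have h_vel : timeShift h e (y t) • w t =
      (√(freqSq μ (y t, w t)) * timeShift h e (y t) / ‖y t‖) • anomVel μ (y t, w t) := by
    rw [anomVel, smul_smul]
    congr 1
    field_simp
  rw [smul_orbitShift_orbit h e hf h_ne, hamField_fst_eq_orbitRotation he, h_inner, h_vel, orbit,
    ellipse, orbitVel, ellipseVel, focalRadiusVel]
  simp only [map_add, map_smul]
  module

end AlongField

end Variation

/-! ### Invariant integrals over the Kepler orbits -/

section ShiftPair

variable {E : Type*} [NormedAddCommGroup E] [InnerProductSpace ℝ E]

/-- Along a Kepler orbit, `S` is a primitive of the variation of `Ψ` under `orbitShift`, so that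
the integral of `Ψ` over the orbit does not change along `hamField`. -/
structure IsShiftPair (h : ℝ) (e : E) (Ψ S : E → ℝ) (y : E) : Prop where
  contDiffAt : ContDiffAt ℝ 1 Ψ y
  differentiableAt : DifferentiableAt ℝ S y
  fderiv_eq : ∀ v, fderiv ℝ Ψ y (orbitShift h e y v) = fderiv ℝ S y v

namespace IsShiftPair

variable {h : ℝ} {e y : E} {Ψ S Ψ₁ S₁ Ψ₂ S₂ : E → ℝ}

lemma differentiableAt_left (hΨ : IsShiftPair h e Ψ S y) : DifferentiableAt ℝ Ψ y :=
  hΨ.contDiffAt.differentiableAt one_ne_zero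

lemma add (h₁ : IsShiftPair h e Ψ₁ S₁ y) (h₂ : IsShiftPair h e Ψ₂ S₂ y) :
    IsShiftPair h e (fun y => Ψ₁ y + Ψ₂ y) (fun y => S₁ y + S₂ y) y where
  contDiffAt := h₁.contDiffAt.add h₂.contDiffAt
  differentiableAt := h₁.differentiableAt.add h₂.differentiableAt
  fderiv_eq v := by
    rw [fderiv_fun_add h₁.differentiableAt_left h₂.differentiableAt_left,
      fderiv_fun_add h₁.differentiableAt h₂.differentiableAt, add_apply, add_apply,
      h₁.fderiv_eq, h₂.fderiv_eq]

lemma const_mul (hΨ : IsShiftPair h e Ψ S y) (c : ℝ) :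
    IsShiftPair h e (fun y => c * Ψ y) (fun y => c * S y) y where
  contDiffAt := contDiffAt_const.mul hΨ.contDiffAt
  differentiableAt := hΨ.differentiableAt.const_mul c
  fderiv_eq v := by
    rw [fderiv_const_mul hΨ.differentiableAt_left, fderiv_const_mul hΨ.differentiableAt,
      smul_apply, smul_apply, hΨ.fderiv_eq]

lemma mul (hΨ : IsShiftPair h e Ψ S y) {P G : E → ℝ} (hP : ContDiffAt ℝ 1 P y)
    (hG : DifferentiableAt ℝ G y)
    (hPG : ∀ v, Ψ y * fderiv ℝ P y (orbitShift h e y v) =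
      S y * fderiv ℝ P y v + fderiv ℝ G y v) :
    IsShiftPair h e (fun y => Ψ y * P y) (fun y => S y * P y + G y) y where
  contDiffAt := hΨ.contDiffAt.mul hP
  differentiableAt := (hΨ.differentiableAt.mul (hP.differentiableAt one_ne_zero)).add hG
  fderiv_eq v := by
    have hP' := hP.differentiableAt one_ne_zero
    rw [fderiv_fun_mul hΨ.differentiableAt_left hP',
      fderiv_fun_add (hΨ.differentiableAt.fun_mul hP') hG, fderiv_fun_mul hΨ.differentiableAt hP']
    simp only [add_apply, smul_apply, smul_eq_mul, hPG, hΨ.fderiv_eq]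
    ring

end IsShiftPair

/-- The integral of `Ψ` over the Kepler orbit with initial data `z` with respect to the eccentric
anomaly. -/
def orbitIntegral (μ : ℝ) (Ψ : E → ℝ) (z : E × E) : ℝ :=
  ∫ u in (0 : ℝ)..2 * Real.pi, Ψ (orbit μ z u)

lemma fderiv_orbit_hamField {μ h : ℝ} {e : E} {z : E × E} (he : ‖e‖ = 1) (hf : 0 < freqSq μ z)
    (hz : ∀ u, orbit μ z u ≠ 0) (u : ℝ) :
    fderiv ℝ (fun z => orbit μ z u) z (hamField μ h e z) =
      √(freqSq μ z) • orbitShift h e (orbit μ z u) (orbitVel μ z u)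
        - (√(freqSq μ z) * timeShift h e z.1 / ‖z.1‖) • orbitVel μ z u := by
  have h_smooth : ContDiffAt ℝ 1 (fun z => orbit μ z u) z :=
    (contDiffAt_orbit (fst_ne_zero_of_orbit_ne_zero hz) hf u).comp z
      (contDiffAt_id.prodMk contDiffAt_const)
  have h_curve := hasDerivAt_orbit_hamField (μ := μ) (h := h) (t := 0)
    (y := fun s => z.1 + s • (hamField μ h e z).1) (w := fun s => z.2 + s • (hamField μ h e z).2) he
    (by simpa only [zero_smul, add_zero] using hasDerivAt_add_smul _ _)
    (by simpa only [zero_smul, add_zero] using hasDerivAt_add_smul _ _) (by simpa using hf)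
    (by simpa using hz) u
  simp only [zero_smul, add_zero, Prod.mk.eta] at h_curve
  rw [← (h_smooth.differentiableAt one_ne_zero).lineDeriv_eq_fderiv]
  exact h_curve.deriv

lemma isInvariantAt_orbitIntegral {μ h : ℝ} {e : E} {z : E × E} {Ψ S : E → ℝ} (he : ‖e‖ = 1)
    (hf : 0 < freqSq μ z) (hz : ∀ u, orbit μ z u ≠ 0)
    (hΨ : ∀ u, IsShiftPair h e Ψ S (orbit μ z u)) :
    IsInvariantAt (orbitIntegral μ Ψ) z (hamField μ h e z) := by
  have h_orbit := contDiffAt_orbit (fst_ne_zero_of_orbit_ne_zero hz) hf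
  refine isInvariantAt_intervalIntegral (f := fun p => Ψ (orbit μ p.1 p.2)) Real.two_pi_pos.le
    (fun u _ => (hΨ u).contDiffAt.comp (f := fun p : (E × E) × ℝ => orbit μ p.1 p.2) (z, u)
      (h_orbit u))
    (P := fun u => √(freqSq μ z) * S (orbit μ z u)
      - √(freqSq μ z) * timeShift h e z.1 / ‖z.1‖ * Ψ (orbit μ z u)) (fun u _ => ?_) ?_
  · have h_slice : DifferentiableAt ℝ (fun z => orbit μ z u) z :=
      ((h_orbit u).comp z (contDiffAt_id.prodMk contDiffAt_const)).differentiableAt one_ne_zero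
    refine ((((hΨ u).differentiableAt.hasFDerivAt.comp_hasDerivAt u
      (hasDerivAt_orbit μ z u)).const_mul _).sub
        (((hΨ u).differentiableAt_left.hasFDerivAt.comp_hasDerivAt u
          (hasDerivAt_orbit μ z u)).const_mul _)).congr_deriv ?_
    rw [fderiv_fun_comp z (hΨ u).differentiableAt_left h_slice, ContinuousLinearMap.comp_apply,
      fderiv_orbit_hamField he hf hz, map_sub, map_smul, map_smul, (hΨ u).fderiv_eq, smul_eq_mul,
      smul_eq_mul]
  · have h_periodic := ellipse_periodic z.1 (anomVel μ z) 0
    simp only [orbit, ← h_periodic, zero_add]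

end ShiftPair

section InvariantIntegrals

variable {E : Type*} [NormedAddCommGroup E] [InnerProductSpace ℝ E] {e y : E}

/-- The conformal factor `1 - |x|²` of the central projection `x`, multiplied by `1 + h ^ 2`, in
the normalized chart. -/
def chartFactor (h : ℝ) (e y : E) : ℝ := (1 + h * inner ℝ y e) ^ 2 - (1 + h ^ 2) * ‖y‖ ^ 2

/-- The element of the time `t` along a Kepler orbit in terms of that of the eccentric anomaly, up
to a constant factor. -/
def weight (h : ℝ) (e y : E) : ℝ := ‖y‖ / chartFactor h e y

/-- The hyperbolic Kepler potential of the second center in the normalized chart, up to a constant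
factor. -/
def secondPot (h : ℝ) (e y : E) : ℝ :=
  (1 + 2 * h ^ 2 - h * inner ℝ y e) / ‖y - (2 * h) • e‖

/-- The companion of the potential of the second center in its shift pair. -/
def secondPotShift (h : ℝ) (e y : E) : ℝ :=
  2 * h * (inner ℝ y e - 2 * h) / ‖y - (2 * h) • e‖

section Gradients

lemma contDiffAt_inner_const (e y : E) : ContDiffAt ℝ 1 (fun y => inner ℝ y e) y :=
  contDiffAt_id.inner ℝ contDiffAt_const

lemma contDiff_chartFactor (h : ℝ) (e : E) : ContDiff ℝ 1 (chartFactor h e) :=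
  ((contDiff_const.add (contDiff_const.mul (contDiff_id.inner ℝ contDiff_const))).pow 2).sub
    (contDiff_const.mul (contDiff_id.norm_sq ℝ))

lemma contDiffAt_weight {h : ℝ} (hy : y ≠ 0) (hF : chartFactor h e y ≠ 0) :
    ContDiffAt ℝ 1 (weight h e) y :=
  (contDiffAt_id.norm ℝ hy).div (contDiff_chartFactor h e).contDiffAt hF

lemma contDiffAt_secondPot {h : ℝ} (hy : y ≠ (2 * h) • e) : ContDiffAt ℝ 1 (secondPot h e) y :=
  (contDiffAt_const.sub (contDiffAt_const.mul (contDiffAt_inner_const e y))).div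
    ((contDiffAt_id.sub contDiffAt_const).norm ℝ (sub_ne_zero.2 hy))
    (norm_ne_zero_iff.2 (sub_ne_zero.2 hy))

lemma hasFDerivAt_inner_const (e y : E) :
    HasFDerivAt (fun y => inner ℝ y e) (innerSL ℝ e) y := by
  simp only [real_inner_comm e]
  exact (innerSL ℝ e).hasFDerivAt

lemma hasFDerivAt_norm_sub {p : E} (hy : y ≠ p) :
    HasFDerivAt (fun y => ‖y - p‖) (innerSL ℝ (‖y - p‖⁻¹ • (y - p))) y := by
  have hr := norm_ne_zero_iff.2 (sub_ne_zero.2 hy)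
  have h := ((hasFDerivAt_id y).sub_const p).norm_sq.sqrt (pow_ne_zero 2 hr)
  simp only [id_eq, Real.sqrt_sq (norm_nonneg _)] at h
  refine h.congr_fderiv ?_
  ext v
  simp only [smul_apply, ContinuousLinearMap.comp_apply, innerSL_apply_apply,
    ContinuousLinearMap.id_apply, real_inner_smul_left, nsmul_eq_mul, smul_eq_mul]
  field_simp
  norm_num

lemma hasFDerivAt_norm' (hy : y ≠ 0) : HasFDerivAt (fun y => ‖y‖) (innerSL ℝ (‖y‖⁻¹ • y)) y := by
  simpa only [sub_zero] using hasFDerivAt_norm_sub hy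

lemma hasFDerivAt_affine_div_norm_sub (c k : ℝ) {p : E} (hy : y ≠ p) :
    HasFDerivAt (fun y => (c + k * inner ℝ y e) / ‖y - p‖)
      (innerSL ℝ ((k / ‖y - p‖) • e - ((c + k * inner ℝ y e) / ‖y - p‖ ^ 3) • (y - p))) y := by
  have hr := norm_ne_zero_iff.2 (sub_ne_zero.2 hy)
  refine (hasFDerivAt_div (((hasFDerivAt_inner_const e y).const_mul k).const_add c)
    (hasFDerivAt_norm_sub hy) hr).congr_fderiv ?_
  ext v
  simp only [sub_apply, smul_apply, innerSL_apply_apply, real_inner_smul_left, inner_sub_left,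
    smul_eq_mul]
  field_simp

lemma hasFDerivAt_chartFactor (h : ℝ) (e y : E) : HasFDerivAt (chartFactor h e)
    (innerSL ℝ ((2 * h * (1 + h * inner ℝ y e)) • e - (2 * (1 + h ^ 2)) • y)) y := by
  refine (((((hasFDerivAt_inner_const e y).const_mul h).const_add 1).pow 2).fun_sub
    ((hasFDerivAt_id y).norm_sq.const_mul (1 + h ^ 2))).congr_fderiv ?_
  ext v
  simp only [sub_apply, smul_apply, ContinuousLinearMap.comp_apply, innerSL_apply_apply,
    ContinuousLinearMap.id_apply, real_inner_smul_left, inner_sub_left, smul_eq_mul, id_eq]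
  ring

lemma hasFDerivAt_timeShift (h : ℝ) (e y : E) : HasFDerivAt (timeShift h e)
    (innerSL ℝ ((2 * h + 4 * h ^ 2 * inner ℝ y e) • e - (4 * h ^ 2) • y)) y := by
  have h_inner := hasFDerivAt_inner_const e y
  refine ((h_inner.const_mul (2 * h)).fun_add (((h_inner.pow 2).fun_sub
    (hasFDerivAt_id y).norm_sq).const_mul (2 * h ^ 2))).congr_fderiv ?_
  ext v
  simp only [add_apply, sub_apply, smul_apply, ContinuousLinearMap.comp_apply, innerSL_apply_apply,
    ContinuousLinearMap.id_apply, real_inner_smul_left, inner_sub_left, smul_eq_mul, id_eq]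
  ring

lemma hasFDerivAt_secondPot {h : ℝ} (hy : y ≠ (2 * h) • e) : HasFDerivAt (secondPot h e)
    (innerSL ℝ (-(h / ‖y - (2 * h) • e‖) • e
      - ((1 + 2 * h ^ 2 - h * inner ℝ y e) / ‖y - (2 * h) • e‖ ^ 3) • (y - (2 * h) • e))) y := by
  simpa only [secondPot, neg_mul, ← sub_eq_add_neg, neg_div] using!
    hasFDerivAt_affine_div_norm_sub (e := e) (1 + 2 * h ^ 2) (-h) hy

lemma hasFDerivAt_secondPotShift {h : ℝ} (hy : y ≠ (2 * h) • e) :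
    HasFDerivAt (secondPotShift h e) (innerSL ℝ ((2 * h / ‖y - (2 * h) • e‖) • e
      - (2 * h * (inner ℝ y e - 2 * h) / ‖y - (2 * h) • e‖ ^ 3) • (y - (2 * h) • e))) y := by
  have h_eq (x : E) : -(2 * h) * (2 * h) + 2 * h * inner ℝ x e = 2 * h * (inner ℝ x e - 2 * h) := by
    ring
  simpa only [h_eq] using! hasFDerivAt_affine_div_norm_sub (e := e) (-(2 * h) * (2 * h)) (2 * h) hy

end Gradients

lemma inner_orbitShift (hy : y ≠ 0) (h : ℝ) (e v : E) :
    inner ℝ y (orbitShift h e y v) = 2 * h * ‖y‖ * inner ℝ v e := by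
  have hr := norm_ne_zero_iff.2 hy
  simp only [orbitShift, orbitRotation, add_apply, smul_apply, wedge_apply, perp_apply,
    inner_add_right, inner_sub_right, inner_sub_left, real_inner_smul_left, real_inner_smul_right,
    real_inner_comm y e, real_inner_comm y v, real_inner_self_eq_norm_sq]
  field_simp
  ring

lemma inner_axis_orbitShift (he : ‖e‖ = 1) (hy : y ≠ 0) (h : ℝ) (v : E) :
    inner ℝ e (orbitShift h e y v) = (2 * ‖y‖ ^ 2 * inner ℝ v e - 2 * inner ℝ y v * inner ℝ y e
      + 2 * h * inner ℝ y v) / ‖y‖ := by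
  have hr := norm_ne_zero_iff.2 hy
  simp only [orbitShift, orbitRotation, add_apply, smul_apply, wedge_apply, perp_apply,
    inner_add_right, inner_sub_right, inner_sub_left, real_inner_smul_left, real_inner_smul_right,
    real_inner_comm y e, real_inner_comm v e, real_inner_comm y v,
    real_inner_self_eq_norm_sq, he]
  field_simp
  ring

lemma isShiftPair_norm (h : ℝ) (e : E) (hy : y ≠ 0) :
    IsShiftPair h e (fun y => ‖y‖) (fun y => 2 * h * inner ℝ y e) y where
  contDiffAt := contDiffAt_id.norm ℝ hy
  differentiableAt := ((hasFDerivAt_inner_const e y).const_mul (2 * h)).differentiableAt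
  fderiv_eq v := by
    have hr := norm_ne_zero_iff.2 hy
    rw [(hasFDerivAt_norm' hy).fderiv, ((hasFDerivAt_inner_const e y).const_mul (2 * h)).fderiv,
      smul_apply, innerSL_apply_apply, innerSL_apply_apply, real_inner_smul_left,
      inner_orbitShift hy, real_inner_comm e v, smul_eq_mul]
    field_simp

lemma isShiftPair_weight {h : ℝ} (he : ‖e‖ = 1) (hy : y ≠ 0) (hF : chartFactor h e y ≠ 0) :
    IsShiftPair h e (weight h e) (fun y => timeShift h e y / chartFactor h e y) y where
  contDiffAt := contDiffAt_weight hy hF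
  differentiableAt :=
    (hasFDerivAt_div (hasFDerivAt_timeShift h e y) (hasFDerivAt_chartFactor h e y)
      hF).differentiableAt
  fderiv_eq v := by
    have hr := norm_ne_zero_iff.2 hy
    have h_weight := hasFDerivAt_div (hasFDerivAt_norm' hy) (hasFDerivAt_chartFactor h e y) hF
    have h_shift := hasFDerivAt_div (hasFDerivAt_timeShift h e y) (hasFDerivAt_chartFactor h e y) hF
    rw [show weight h e = fun y => ‖y‖ / chartFactor h e y from rfl, h_weight.fderiv,
      h_shift.fderiv]
    simp only [smul_apply, sub_apply, innerSL_apply_apply, inner_sub_left, real_inner_smul_left,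
      inner_orbitShift hy, inner_axis_orbitShift he hy, real_inner_comm v e, smul_eq_mul]
    rw [timeShift, chartFactor] at *
    field_simp
    ring

lemma norm_mul_fderiv_secondPot_orbitShift {h : ℝ} (he : ‖e‖ = 1) (hy : y ≠ 0)
    (hy' : y ≠ (2 * h) • e) (v : E) :
    ‖y‖ * fderiv ℝ (secondPot h e) y (orbitShift h e y v) =
      timeShift h e y * fderiv ℝ (secondPot h e) y v
        + chartFactor h e y * fderiv ℝ (secondPotShift h e) y v := by
  have hr := norm_ne_zero_iff.2 hy
  have hr' := norm_ne_zero_iff.2 (sub_ne_zero.2 hy')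
  have h_sq : ‖y - (2 * h) • e‖ ^ 2 = ‖y‖ ^ 2 - 4 * h * inner ℝ y e + 4 * h ^ 2 := by
    rw [norm_sub_sq_real, real_inner_smul_right, norm_smul, Real.norm_eq_abs, mul_pow, sq_abs, he]
    ring
  rw [(hasFDerivAt_secondPot hy').fderiv, (hasFDerivAt_secondPotShift hy').fderiv]
  simp only [innerSL_apply_apply, inner_sub_left, real_inner_smul_left, inner_orbitShift hy,
    inner_axis_orbitShift he hy, real_inner_comm v e]
  generalize ‖y - (2 * h) • e‖ = q at h_sq hr'
  rw [timeShift, chartFactor]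
  field_simp
  linear_combination (-h * (inner ℝ v e - inner ℝ y v * inner ℝ y e
    + h * (inner ℝ v e * inner ℝ y e + inner ℝ y v))) * h_sq

lemma isShiftPair_weight_mul_secondPot {h : ℝ} (he : ‖e‖ = 1) (hy : y ≠ 0)
    (hF : chartFactor h e y ≠ 0) (hy' : y ≠ (2 * h) • e) :
    IsShiftPair h e (fun y => weight h e y * secondPot h e y) (fun y =>
      timeShift h e y / chartFactor h e y * secondPot h e y + secondPotShift h e y) y := by
  refine (isShiftPair_weight he hy hF).mul (contDiffAt_secondPot hy')
    (hasFDerivAt_secondPotShift hy').differentiableAt fun v => ?_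
  rw [weight, div_mul_eq_mul_div, norm_mul_fderiv_secondPot_orbitShift he hy hy']
  field_simp

/-- The initial data of the bounded Kepler orbits in the normalized chart that stay in the image of
hyperbolic space and avoid both centers. -/
structure IsAdmissible (μ h : ℝ) (e : E) (z : E × E) : Prop where
  freqSq_pos : 0 < freqSq μ z
  orbit_ne_zero : ∀ u, orbit μ z u ≠ 0
  chartFactor_pos : ∀ u, 0 < chartFactor h e (orbit μ z u)
  orbit_ne_second : ∀ u, orbit μ z u ≠ (2 * h) • e

/-- The general integrand whose integral over the Kepler orbits is constant along `hamField`. -/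
def invariantIntegrand (h : ℝ) (e : E) (α β γ : ℝ) (y : E) : ℝ :=
  α * (weight h e y * secondPot h e y) + β * weight h e y + γ * ‖y‖

lemma continuous_orbit (μ : ℝ) (z : E × E) : Continuous (orbit μ z) := continuous_ellipse _ _

namespace IsAdmissible

variable {μ h : ℝ} {z : E × E}

lemma fst_ne_zero (hz : IsAdmissible μ h e z) : z.1 ≠ 0 :=
  fst_ne_zero_of_orbit_ne_zero hz.orbit_ne_zero

lemma of_mem_Icc (hf : 0 < freqSq μ z) (hz : ∀ u ∈ Set.Icc 0 (2 * Real.pi),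
    orbit μ z u ≠ 0 ∧ 0 < chartFactor h e (orbit μ z u) ∧ orbit μ z u ≠ (2 * h) • e) :
    IsAdmissible μ h e z := by
  have h_all (u : ℝ) :
      orbit μ z u ≠ 0 ∧ 0 < chartFactor h e (orbit μ z u) ∧ orbit μ z u ≠ (2 * h) • e := by
    obtain ⟨u', hu', h_eq⟩ :=
      (ellipse_periodic z.1 (anomVel μ z)).exists_mem_Ico₀ Real.two_pi_pos u
    rw [orbit, h_eq]
    exact hz u' ⟨hu'.1, hu'.2.le⟩
  exact ⟨hf, fun u => (h_all u).1, fun u => (h_all u).2.1, fun u => (h_all u).2.2⟩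

lemma eventually (hz : IsAdmissible μ h e z) : ∀ᶠ z' in nhds z, IsAdmissible μ h e z' := by
  have h_freq : ∀ᶠ z' in nhds z, 0 < freqSq μ z' :=
    (contDiffAt_freqSq μ hz.fst_ne_zero).continuousAt.eventually_const_lt hz.freqSq_pos
  have h_orbit : ∀ᶠ z' in nhds z, ∀ u ∈ Set.Icc (0 : ℝ) (2 * Real.pi), orbit μ z' u ≠ 0 ∧
      0 < chartFactor h e (orbit μ z' u) ∧ orbit μ z' u ≠ (2 * h) • e := by
    refine isCompact_Icc.eventually_forall_of_forall_eventually fun u _ => ?_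
    have h_cont := (contDiffAt_orbit hz.fst_ne_zero hz.freqSq_pos u).continuousAt
    exact (h_cont.eventually_ne (hz.orbit_ne_zero u)).and
      ((((contDiff_chartFactor h e).continuous.continuousAt.comp h_cont).eventually_const_lt
        (hz.chartFactor_pos u)).and (h_cont.eventually_ne (hz.orbit_ne_second u)))
  exact (h_freq.and h_orbit).mono fun z' hz' => of_mem_Icc hz'.1 hz'.2

lemma isInvariantAt_orbitIntegral (he : ‖e‖ = 1) (hz : IsAdmissible μ h e z) (α β γ : ℝ) :
    IsInvariantAt (orbitIntegral μ (invariantIntegrand h e α β γ)) z (hamField μ h e z) :=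
  HypKepler.isInvariantAt_orbitIntegral he hz.freqSq_pos hz.orbit_ne_zero fun u =>
    (((isShiftPair_weight_mul_secondPot he (hz.orbit_ne_zero u) (hz.chartFactor_pos u).ne'
      (hz.orbit_ne_second u)).const_mul α).add ((isShiftPair_weight he (hz.orbit_ne_zero u)
        (hz.chartFactor_pos u).ne').const_mul β)).add
          ((isShiftPair_norm h e (hz.orbit_ne_zero u)).const_mul γ)

lemma continuous_weight (hz : IsAdmissible μ h e z) :
    Continuous fun u => weight h e (orbit μ z u) :=
  continuous_iff_continuousAt.2 fun u =>
    (contDiffAt_weight (hz.orbit_ne_zero u) (hz.chartFactor_pos u).ne').continuousAt.comp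
      (continuous_orbit μ z).continuousAt

lemma orbitIntegral_weight_pos (hz : IsAdmissible μ h e z) : 0 < orbitIntegral μ (weight h e) z :=
  intervalIntegral.intervalIntegral_pos_of_pos (hz.continuous_weight.intervalIntegrable _ _)
    (fun u => div_pos (norm_pos_iff.2 (hz.orbit_ne_zero u)) (hz.chartFactor_pos u))
    Real.two_pi_pos

end IsAdmissible

end InvariantIntegrals

/-! ### The normalized chart -/

section Chart

variable {d : ℕ}

section HyperbolicSpace

lemma norm_fst_sq_of_mem_hyp {q : Mink d} (hq : q ∈ Hyp d) : ‖q.1‖ ^ 2 = q.2 ^ 2 - 1 := by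
  have h := hq.1
  rw [mink, real_inner_self_eq_norm_sq] at h
  linarith

lemma lift_mem_hyp {x : Eu d} (hx : ‖x‖ ^ 2 < 1) : lift x ∈ Hyp d := by
  have h_pos : 0 < √(1 - ‖x‖ ^ 2) := Real.sqrt_pos.2 (by linarith)
  refine ⟨?_, inv_pos.2 h_pos⟩
  rw [mink, lift, real_inner_smul_left, real_inner_smul_right, real_inner_self_eq_norm_sq]
  field_simp
  linear_combination Real.sq_sqrt (by linarith : 0 ≤ 1 - ‖x‖ ^ 2)

lemma sqrt_one_sub_norm_centralProjection_sq {q : Mink d} (hq : q ∈ Hyp d) :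
    √(1 - ‖q.2⁻¹ • q.1‖ ^ 2) = q.2⁻¹ := by
  have hq2 : 0 < q.2 := hq.2
  rw [norm_smul, mul_pow, norm_inv, Real.norm_eq_abs, inv_pow, sq_abs, norm_fst_sq_of_mem_hyp hq,
    show 1 - (q.2 ^ 2)⁻¹ * (q.2 ^ 2 - 1) = q.2⁻¹ ^ 2 by field_simp; ring]
  exact Real.sqrt_sq (by positivity)

lemma lift_centralProjection {q : Mink d} (hq : q ∈ Hyp d) : lift (q.2⁻¹ • q.1) = q := by
  rw [lift, sqrt_one_sub_norm_centralProjection_sq hq, inv_inv, smul_inv_smul₀ hq.2.ne']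

lemma centralProjection_lift {x : Eu d} (hx : ‖x‖ ^ 2 < 1) : (lift x).2⁻¹ • (lift x).1 = x := by
  have h_ne : √(1 - ‖x‖ ^ 2) ≠ 0 := (Real.sqrt_pos.2 (by linarith)).ne'
  rw [lift, inv_inv, smul_inv_smul₀ h_ne]

lemma coth_arcosh {X : ℝ} (hX : 1 ≤ X) : coth (Real.arcosh X) = X / √(X ^ 2 - 1) := by
  rw [coth, Real.cosh_arcosh hX, Real.sinh_arcosh hX]

lemma neg_mink_lift_pos {x : Eu d} (hx : ‖x‖ ^ 2 < 1) {q : Mink d} (hq : q ∈ Hyp d) :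
    0 < -mink q (lift x) := by
  have hq2 : 0 < q.2 := hq.2
  have h_lt : inner ℝ q.1 x < q.2 := by
    have hx1 : ‖x‖ < 1 := by nlinarith [norm_nonneg x]
    have hq1 : ‖q.1‖ < q.2 := by nlinarith [norm_fst_sq_of_mem_hyp hq, norm_nonneg q.1]
    calc inner ℝ q.1 x ≤ ‖q.1‖ * ‖x‖ := real_inner_le_norm _ _
      _ ≤ ‖q.1‖ * 1 := by gcongr
      _ < q.2 := by rwa [mul_one]
  have h_eq : -mink q (lift x) = (√(1 - ‖x‖ ^ 2))⁻¹ * (q.2 - inner ℝ q.1 x) := by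
    rw [mink, lift, real_inner_smul_right]
    ring
  rw [h_eq]
  exact mul_pos (inv_pos.2 (Real.sqrt_pos.2 (by linarith))) (sub_pos.2 h_lt)

lemma coth_hdist_lift {x : Eu d} (hx : ‖x‖ ^ 2 < 1) {q : Mink d} (hq : q ∈ Hyp d) {r : ℝ}
    (hr : 0 ≤ r) (h : (-mink q (lift x)) ^ 2 - 1 = r ^ 2) :
    coth (hdist q (lift x)) = -mink q (lift x) / r := by
  have h_one : 1 ≤ -mink q (lift x) :=
    le_of_sq_le_sq (by nlinarith [sq_nonneg r]) (neg_mink_lift_pos hx hq).le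
  rw [hdist, coth_arcosh h_one, h, Real.sqrt_sq hr]

lemma norm_smul_sq_of_norm_eq_one {e : Eu d} (he : ‖e‖ = 1) (c : ℝ) : ‖c • e‖ ^ 2 = c ^ 2 := by
  rw [norm_smul, he, mul_one, Real.norm_eq_abs, sq_abs]

end HyperbolicSpace

lemma affInner_eq_inner_axisScale {a : ℝ} (ha : a ^ 2 < 1) {e : Eu d} (he : ‖e‖ = 1) (x y : Eu d) :
    affInner a e x y =
      inner ℝ (axisScale (√(1 - a ^ 2))⁻¹ e x) (axisScale (√(1 - a ^ 2))⁻¹ e y) := by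
  rw [inner_axisScale he, affInner, inv_pow, Real.sq_sqrt (by linarith)]

/-- The parameter `h` of the normalized chart: half of the distance of the centers, with a minus
sign because `e` points from the second center to the first. -/
def signedHalfDist (a : ℝ) : ℝ := -(a / √(1 - a ^ 2))

/-- The normalized position in the chart of central projection: the first center is the origin,
the second one is `2 * signedHalfDist a • e`, and the norm `‖·‖_a` becomes the Euclidean one. -/
def normChartPos (a : ℝ) (e : Eu d) (q : Mink d) : Eu d :=
  axisScale (√(1 - a ^ 2))⁻¹ e (q.2⁻¹ • q.1) + signedHalfDist a • e

/-- The normalized velocity in the chart of central projection. -/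
def normChartVel (a : ℝ) (e : Eu d) (z : Mink d × Mink d) : Eu d :=
  axisScale (√(1 - a ^ 2))⁻¹ e (chartVel z)

/-- The normalized chart of `Tℍ^d`. -/
def normChart (a : ℝ) (e : Eu d) (z : Mink d × Mink d) : Eu d × Eu d :=
  (normChartPos a e z.1, normChartVel a e z)

/-- The point of hyperbolic space with normalized position `y`. -/
def ofNormChart (a : ℝ) (e y : Eu d) : Mink d :=
  lift (axisScale (√(1 - a ^ 2)) e (y - signedHalfDist a • e))

/-- The factor `1 - |x|²` of the central projection `x` in terms of the normalized position. -/
def confFactor (a : ℝ) (e y : Eu d) : ℝ := (1 - a ^ 2) * chartFactor (signedHalfDist a) e y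

variable {a : ℝ} {e : Eu d}

lemma sqrt_one_sub_sq_pos (ha : a ^ 2 < 1) : 0 < √(1 - a ^ 2) := Real.sqrt_pos.2 (by linarith)

lemma one_add_signedHalfDist_sq_mul (ha : a ^ 2 < 1) :
    (1 + signedHalfDist a ^ 2) * (1 - a ^ 2) = 1 := by
  have hb : 1 - a ^ 2 ≠ 0 := by linarith
  rw [signedHalfDist, neg_sq, div_pow, Real.sq_sqrt (by linarith)]
  field_simp
  ring

lemma axisScale_normChartPos_sub (ha : a ^ 2 < 1) (he : ‖e‖ = 1) (q : Mink d) :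
    axisScale (√(1 - a ^ 2)) e (normChartPos a e q - signedHalfDist a • e) = q.2⁻¹ • q.1 := by
  rw [normChartPos, add_sub_cancel_right, axisScale_axisScale he,
    mul_inv_cancel₀ (sqrt_one_sub_sq_pos ha).ne', axisScale_one]

lemma axisScale_normChartVel (ha : a ^ 2 < 1) (he : ‖e‖ = 1) (z : Mink d × Mink d) :
    axisScale (√(1 - a ^ 2)) e (normChartVel a e z) = chartVel z := by
  rw [normChartVel, axisScale_axisScale he, mul_inv_cancel₀ (sqrt_one_sub_sq_pos ha).ne',
    axisScale_one]

lemma one_sub_norm_axisScale_sq (ha : a ^ 2 < 1) (he : ‖e‖ = 1) (y : Eu d) :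
    1 - ‖axisScale (√(1 - a ^ 2)) e (y - signedHalfDist a • e)‖ ^ 2 =
      confFactor a e y := by
  rw [norm_axisScale_sq he, Real.sq_sqrt (by linarith), norm_sub_sq_real, real_inner_smul_right,
    norm_smul_sq_of_norm_eq_one he, inner_sub_left, real_inner_smul_left,
    real_inner_self_eq_norm_sq, he, confFactor, chartFactor]
  linear_combination (‖y‖ ^ 2 - inner ℝ y e ^ 2 - 1) * one_add_signedHalfDist_sq_mul ha

lemma snd_sq_mul_confFactor (ha : a ^ 2 < 1) (he : ‖e‖ = 1) {q : Mink d} (hq : q ∈ Hyp d) :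
    q.2 ^ 2 * confFactor a e (normChartPos a e q) = 1 := by
  have hq2 := hq.2.ne'
  rw [← one_sub_norm_axisScale_sq ha he, axisScale_normChartPos_sub ha he, norm_smul, mul_pow,
    norm_inv, Real.norm_eq_abs, inv_pow, sq_abs, norm_fst_sq_of_mem_hyp hq]
  field_simp
  ring

lemma confFactor_normChartPos_pos (ha : a ^ 2 < 1) (he : ‖e‖ = 1) {q : Mink d} (hq : q ∈ Hyp d) :
    0 < confFactor a e (normChartPos a e q) :=
  pos_of_mul_pos_right (by rw [snd_sq_mul_confFactor ha he hq]; exact one_pos) (sq_nonneg q.2)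

lemma confFactor_pos_iff (ha : a ^ 2 < 1) {y : Eu d} :
    0 < confFactor a e y ↔ 0 < chartFactor (signedHalfDist a) e y :=
  mul_pos_iff_of_pos_left (by linarith)

lemma inner_fst_axis (ha : a ^ 2 < 1) (he : ‖e‖ = 1) {q : Mink d} (hq : q ∈ Hyp d) :
    inner ℝ q.1 e = q.2 * (√(1 - a ^ 2) * inner ℝ (normChartPos a e q) e + a) := by
  have hb := (sqrt_one_sub_sq_pos ha).ne'
  have h_proj : inner ℝ (q.2⁻¹ • q.1) e = √(1 - a ^ 2) * inner ℝ (normChartPos a e q) e + a := by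
    rw [← axisScale_normChartPos_sub ha he, inner_axisScale_axis he, inner_sub_left,
      real_inner_smul_left, real_inner_self_eq_norm_sq, he, signedHalfDist]
    field_simp
    ring
  rw [← h_proj, real_inner_smul_left, mul_inv_cancel_left₀ hq.2.ne']

lemma neg_mink_lift_smul (ha : a ^ 2 < 1) (he : ‖e‖ = 1) {c : ℝ} (hc : c ^ 2 = a ^ 2) {q : Mink d}
    (hq : q ∈ Hyp d) : -mink q (lift (c • e)) =
      q.2 * ((1 - c * a) / √(1 - a ^ 2) - c * inner ℝ (normChartPos a e q) e) := by
  have hb := (sqrt_one_sub_sq_pos ha).ne'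
  simp only [mink, lift, norm_smul_sq_of_norm_eq_one he, hc, real_inner_smul_right,
    inner_fst_axis ha he hq]
  field_simp
  ring

lemma neg_mink_lift_first (ha : a ^ 2 < 1) (he : ‖e‖ = 1) {q : Mink d} (hq : q ∈ Hyp d) :
    -mink q (lift (a • e)) = q.2 * √(1 - a ^ 2) *
      (1 + signedHalfDist a * inner ℝ (normChartPos a e q) e) := by
  have hb := (sqrt_one_sub_sq_pos ha).ne'
  have hb2 : √(1 - a ^ 2) ^ 2 = 1 - a ^ 2 := Real.sq_sqrt (by linarith)
  rw [neg_mink_lift_smul ha he rfl hq, signedHalfDist]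
  field_simp
  linear_combination -q.2 * hb2

lemma neg_mink_lift_second (ha : a ^ 2 < 1) (he : ‖e‖ = 1) {q : Mink d} (hq : q ∈ Hyp d) :
    -mink q (lift (-a • e)) = q.2 * √(1 - a ^ 2) *
      (1 + 2 * signedHalfDist a ^ 2 - signedHalfDist a * inner ℝ (normChartPos a e q) e) := by
  have hb := (sqrt_one_sub_sq_pos ha).ne'
  have hb2 : √(1 - a ^ 2) ^ 2 = 1 - a ^ 2 := Real.sq_sqrt (by linarith)
  rw [neg_mink_lift_smul ha he (neg_sq a) hq, signedHalfDist]
  field_simp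
  linear_combination -q.2 * hb2

lemma neg_mink_lift_first_sq_sub_one (ha : a ^ 2 < 1) (he : ‖e‖ = 1) {q : Mink d}
    (hq : q ∈ Hyp d) :
    (-mink q (lift (a • e))) ^ 2 - 1 = (q.2 * ‖normChartPos a e q‖) ^ 2 := by
  have h_factor := snd_sq_mul_confFactor ha he hq
  rw [confFactor, chartFactor] at h_factor
  rw [neg_mink_lift_first ha he hq, mul_pow, mul_pow, Real.sq_sqrt (by linarith)]
  linear_combination h_factor +
    q.2 ^ 2 * ‖normChartPos a e q‖ ^ 2 * one_add_signedHalfDist_sq_mul ha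

lemma norm_sub_smul_sq (he : ‖e‖ = 1) (c : ℝ) (y : Eu d) :
    ‖y - c • e‖ ^ 2 = ‖y‖ ^ 2 - 2 * c * inner ℝ y e + c ^ 2 := by
  rw [norm_sub_sq_real, real_inner_smul_right, norm_smul_sq_of_norm_eq_one he]
  ring

lemma neg_mink_lift_second_sq_sub_one (ha : a ^ 2 < 1) (he : ‖e‖ = 1) {q : Mink d}
    (hq : q ∈ Hyp d) : (-mink q (lift (-a • e))) ^ 2 - 1 =
      (q.2 * ‖normChartPos a e q - (2 * signedHalfDist a) • e‖) ^ 2 := by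
  have h_factor := snd_sq_mul_confFactor ha he hq
  rw [confFactor, chartFactor] at h_factor
  rw [neg_mink_lift_second ha he hq, mul_pow, mul_pow, Real.sq_sqrt (by linarith), mul_pow,
    norm_sub_smul_sq he]
  linear_combination h_factor + q.2 ^ 2 * (‖normChartPos a e q‖ ^ 2
    - 4 * signedHalfDist a * inner ℝ (normChartPos a e q) e
    + 4 * signedHalfDist a ^ 2) * one_add_signedHalfDist_sq_mul ha

lemma keplerPot_first (ha : a ^ 2 < 1) (he : ‖e‖ = 1) (m : ℝ) {q : Mink d} (hq : q ∈ Hyp d) :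
    keplerPot m (lift (a • e)) q = -(m * √(1 - a ^ 2) *
      (1 + signedHalfDist a * inner ℝ (normChartPos a e q) e) / ‖normChartPos a e q‖) := by
  have hq2 : 0 < q.2 := hq.2
  rw [keplerPot, coth_hdist_lift (by rwa [norm_smul_sq_of_norm_eq_one he]) hq (by positivity)
    (neg_mink_lift_first_sq_sub_one ha he hq), neg_mink_lift_first ha he hq]
  field_simp

lemma keplerPot_second (ha : a ^ 2 < 1) (he : ‖e‖ = 1) (m : ℝ) {q : Mink d} (hq : q ∈ Hyp d) :
    keplerPot m (lift (-a • e)) q =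
      -(m * √(1 - a ^ 2) * secondPot (signedHalfDist a) e (normChartPos a e q)) := by
  have hq2 : 0 < q.2 := hq.2
  rw [keplerPot, coth_hdist_lift (by rwa [norm_smul_sq_of_norm_eq_one he, neg_sq]) hq
    (by positivity) (neg_mink_lift_second_sq_sub_one ha he hq), neg_mink_lift_second ha he hq,
    secondPot]
  field_simp

lemma hookePot_midpoint (ha : a ^ 2 < 1) (he : ‖e‖ = 1) (f : ℝ) {q : Mink d} (hq : q ∈ Hyp d) :
    hookePot f (lift 0) q = f * (1 - confFactor a e (normChartPos a e q)) := by
  have hq2 : 0 < q.2 := hq.2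
  have h_mink : -mink q (lift 0) = q.2 := by simp [mink, lift]
  have h_norm := norm_fst_sq_of_mem_hyp hq
  have h_one : 1 ≤ q.2 := by nlinarith [sq_nonneg ‖q.1‖]
  rw [hookePot, hdist, h_mink, Real.tanh_arcosh h_one, div_pow, Real.sq_sqrt (by nlinarith)]
  field_simp
  linear_combination f * snd_sq_mul_confFactor ha he hq

lemma ofNormChart_normChartPos (ha : a ^ 2 < 1) (he : ‖e‖ = 1) {q : Mink d} (hq : q ∈ Hyp d) :
    ofNormChart a e (normChartPos a e q) = q := by
  rw [ofNormChart, axisScale_normChartPos_sub ha he, lift_centralProjection hq]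

lemma norm_axisScale_sq_lt_one (ha : a ^ 2 < 1) (he : ‖e‖ = 1) {y : Eu d}
    (hy : 0 < confFactor a e y) :
    ‖axisScale (√(1 - a ^ 2)) e (y - signedHalfDist a • e)‖ ^ 2 < 1 := by
  linarith [one_sub_norm_axisScale_sq ha he y]

lemma normChartPos_ofNormChart (ha : a ^ 2 < 1) (he : ‖e‖ = 1) {y : Eu d}
    (hy : 0 < confFactor a e y) : normChartPos a e (ofNormChart a e y) = y := by
  rw [normChartPos, ofNormChart, centralProjection_lift (norm_axisScale_sq_lt_one ha he hy),
    axisScale_axisScale he, inv_mul_cancel₀ (sqrt_one_sub_sq_pos ha).ne', axisScale_one,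
    sub_add_cancel]

lemma ofNormChart_zero (ha : a ^ 2 < 1) (he : ‖e‖ = 1) : ofNormChart a e 0 = lift (a • e) := by
  rw [ofNormChart, zero_sub, map_neg, map_smul, axisScale_self he, signedHalfDist, smul_smul,
    neg_mul, div_mul_cancel₀ _ (sqrt_one_sub_sq_pos ha).ne', neg_smul, neg_neg]

lemma ofNormChart_second (ha : a ^ 2 < 1) (he : ‖e‖ = 1) :
    ofNormChart a e ((2 * signedHalfDist a) • e) = lift (-a • e) := by
  rw [ofNormChart, show (2 * signedHalfDist a) • e - signedHalfDist a • e = signedHalfDist a • e by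
    module, map_smul, axisScale_self he, signedHalfDist, smul_smul, neg_mul,
    div_mul_cancel₀ _ (sqrt_one_sub_sq_pos ha).ne']

end Chart

/-! ### The Poisson bracket in the normalized chart -/

section Invariants

variable {E : Type*} [NormedAddCommGroup E] [InnerProductSpace ℝ E] {e : E} {z : E × E}

lemma hasFDerivAt_chartD (μ h : ℝ) (e : E) (hz : z.1 ≠ 0) :
    HasFDerivAt (chartD μ h e)
      ((innerSL ℝ (gradPos μ h e z)).coprod (innerSL ℝ (gradVel h e z))) z := by
  have hr := norm_ne_zero_iff.2 hz
  have h_norm : HasFDerivAt (fun z : E × E => ‖z.1‖) _ z :=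
    (hasFDerivAt_norm' hz).comp z hasFDerivAt_fst
  have h_y : HasFDerivAt (fun z : E × E => inner ℝ z.1 e) _ z :=
    (hasFDerivAt_inner_const e z.1).comp z hasFDerivAt_fst
  have h_w : HasFDerivAt (fun z : E × E => inner ℝ z.2 e) _ z :=
    (hasFDerivAt_inner_const e z.2).comp z hasFDerivAt_snd
  have h_yw : HasFDerivAt (fun z : E × E => inner ℝ z.1 z.2) _ z :=
    hasFDerivAt_fst.inner ℝ hasFDerivAt_snd
  have h_y2 : HasFDerivAt (fun z : E × E => ‖z.1‖ ^ 2) _ z := hasFDerivAt_fst.norm_sq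
  have h_w2 : HasFDerivAt (fun z : E × E => ‖z.2‖ ^ 2) _ z := hasFDerivAt_snd.norm_sq
  refine (((h_y2.mul h_w2).sub (h_yw.pow 2)).sub ((((h_w2.mul h_y).sub (h_yw.mul h_w)).sub
    (hasFDerivAt_div (h_y.const_mul μ) h_norm hr)).const_mul (2 * h))).congr_fderiv ?_
  ext v
  · simp only [Nat.add_one_sub_one, pow_one, nsmul_eq_mul, Nat.cast_ofNat, Prod.mk.eta,
      ContinuousLinearMap.fst_prod_snd, ContinuousLinearMap.comp_id, map_smul,
      ContinuousLinearMap.smul_comp, ContinuousLinearMap.sub_comp, ContinuousLinearMap.add_comp,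
      sub_apply, add_apply, smul_apply, ContinuousLinearMap.comp_apply,
      ContinuousLinearMap.inl_apply, ContinuousLinearMap.coe_snd', coe_innerSL_apply,
      inner_zero_right, smul_eq_mul, mul_zero, ContinuousLinearMap.coe_fst', zero_add,
      fderivInnerCLM_apply, add_zero, gradPos, map_add, gradVel, ContinuousLinearMap.coprod_add,
      ContinuousLinearMap.coprod_comp_inl, real_inner_comm v z.2]
    field_simp
    ring
  · simp only [Nat.add_one_sub_one, pow_one, nsmul_eq_mul, Nat.cast_ofNat, Prod.mk.eta,
      ContinuousLinearMap.fst_prod_snd, ContinuousLinearMap.comp_id, map_smul,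
      ContinuousLinearMap.smul_comp, ContinuousLinearMap.sub_comp, ContinuousLinearMap.add_comp,
      sub_apply, add_apply, smul_apply, ContinuousLinearMap.comp_apply,
      ContinuousLinearMap.inr_apply, ContinuousLinearMap.coe_snd', coe_innerSL_apply, smul_eq_mul,
      ContinuousLinearMap.coe_fst', inner_zero_right, mul_zero, add_zero,
      fderivInnerCLM_apply, inner_zero_left, zero_add, sub_self, sub_zero, gradPos, map_add,
      gradVel, ContinuousLinearMap.coprod_add, ContinuousLinearMap.coprod_comp_inr]
    ring

lemma inner_chartCometric_left (h : ℝ) (e p x x' : E) :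
    inner ℝ (chartCometric h e p x) x' = inner ℝ x (chartCometric h e p x') := by
  simp only [chartCometric, inner_add_left, inner_add_right, inner_sub_left, inner_sub_right,
    real_inner_smul_left, real_inner_smul_right, real_inner_comm e, real_inner_comm p]
  ring

lemma isInvariantAt_chartD (μ h : ℝ) (e : E) (hz : z.1 ≠ 0) :
    IsInvariantAt (chartD μ h e) z (hamField μ h e z) := by
  refine .of_hasFDerivAt (hasFDerivAt_chartD μ h e hz) ?_
  rw [hamField]
  generalize z.1 - h • e = p
  simp only [ContinuousLinearMap.coprod_apply, innerSL_apply_apply, inner_add_right,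
    inner_sub_right, inner_neg_right, real_inner_smul_right, ← inner_chartCometric_left,
    real_inner_comm p, real_inner_comm (gradPos μ h e z)]
  ring

/-- The squared angular momentum about the axis. -/
def perpAngMomSq (e : E) (z : E × E) : ℝ :=
  ‖perp e z.1‖ ^ 2 * ‖perp e z.2‖ ^ 2 - inner ℝ (perp e z.1) (perp e z.2) ^ 2

lemma hasDerivAt_gramDet_of_traceless {y w : ℝ → E} {t α β γ : ℝ}
    (hy : HasDerivAt y (α • w t + β • y t) t) (hw : HasDerivAt w (γ • y t - β • w t) t) :
    HasDerivAt (fun s => ‖y s‖ ^ 2 * ‖w s‖ ^ 2 - inner ℝ (y s) (w s) ^ 2) 0 t := by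
  refine ((hy.norm_sq.mul hw.norm_sq).sub ((hy.inner ℝ hw).pow 2)).congr_deriv ?_
  simp only [inner_add_left, inner_add_right, inner_sub_right, real_inner_smul_left,
    real_inner_smul_right, real_inner_self_eq_norm_sq, real_inner_comm (y t) (w t)]
  ring

lemma exists_perp_hamField_eq (he : ‖e‖ = 1) (hz : z.1 ≠ 0) (μ h : ℝ) : ∃ α β γ : ℝ,
    perp e (hamField μ h e z).1 = α • perp e z.2 + β • perp e z.1 ∧
      perp e (hamField μ h e z).2 = γ • perp e z.1 - β • perp e z.2 := by
  obtain ⟨y, w⟩ := z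
  have h_perp : perp e e = 0 := by rw [perp, axisScale_self he, zero_smul]
  simp only [hamField_fst he, hamField_snd he hz, map_add, map_smul, h_perp, smul_zero, add_zero]
  refine ⟨_, _, ?γ, rfl, ?_⟩
  rotate_left
  · rw [add_comm, sub_eq_add_neg (G := E), ← neg_smul]
    congr 2
    exacts [rfl, by ring]

lemma isInvariantAt_perpAngMomSq (he : ‖e‖ = 1) (hz : z.1 ≠ 0) (μ h : ℝ) :
    IsInvariantAt (perpAngMomSq e) z (hamField μ h e z) := by
  have h_diff : DifferentiableAt ℝ (fun z : E × E => (perp e z.1, perp e z.2)) z := by fun_prop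
  have h_y := (perp e).hasFDerivAt.comp_hasDerivAt (0 : ℝ)
    (hasDerivAt_add_smul z.1 (hamField μ h e z).1)
  have h_w := (perp e).hasFDerivAt.comp_hasDerivAt (0 : ℝ)
    (hasDerivAt_add_smul z.2 (hamField μ h e z).2)
  obtain ⟨α, β, γ, h_fst, h_snd⟩ := exists_perp_hamField_eq he hz μ h
  refine .of_line (((h_diff.fst.norm_sq ℝ).mul (h_diff.snd.norm_sq ℝ)).sub
    ((h_diff.fst.inner ℝ h_diff.snd).pow 2)) ?_
  refine hasDerivAt_gramDet_of_traceless (y := fun s => perp e (z.1 + s • (hamField μ h e z).1))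
    (w := fun s => perp e (z.2 + s • (hamField μ h e z).2)) (α := α) (β := β) (γ := γ) ?_ ?_
  · simpa only [zero_smul, add_zero, h_fst, Function.comp_def] using h_y
  · simpa only [zero_smul, add_zero, h_snd, Function.comp_def] using h_w

lemma isInvariantAt_freqSq (he : ‖e‖ = 1) (hz : z.1 ≠ 0) (μ h : ℝ) :
    IsInvariantAt (freqSq μ) z (hamField μ h e z) := by
  refine .of_line ((contDiffAt_freqSq μ hz).differentiableAt one_ne_zero) ?_
  refine hasDerivAt_freqSq (μ := μ) (h := h) he (y := fun s => z.1 + s • (hamField μ h e z).1)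
    (w := fun s => z.2 + s • (hamField μ h e z).2) ?_ ?_ (by simpa using hz)
  · simpa only [zero_smul, add_zero] using hasDerivAt_add_smul _ _
  · simpa only [zero_smul, add_zero] using hasDerivAt_add_smul _ _

/-- The energy of the hyperbolic Kepler problem in the normalized chart. -/
def chartEnergy (μ h : ℝ) (e : E) (z : E × E) : ℝ :=
  -(2 * (1 + h ^ 2))⁻¹ * (freqSq μ z + chartD μ h e z + h ^ 2 * perpAngMomSq e z)

lemma isInvariantAt_chartEnergy (he : ‖e‖ = 1) (hz : z.1 ≠ 0) (μ h : ℝ) :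
    IsInvariantAt (chartEnergy μ h e) z (hamField μ h e z) :=
  (((isInvariantAt_freqSq he hz μ h).add (isInvariantAt_chartD μ h e hz)).add
    ((isInvariantAt_perpAngMomSq he hz μ h).const_mul _)).const_mul _

end Invariants

section Bracket

variable {d : ℕ} {a : ℝ} {e : Eu d}

lemma canonicalBracket_eq_fderiv {F G : Eu d × Eu d → ℝ} {c : Eu d × Eu d} {gs gp : Eu d}
    (hG : ∀ v, fderiv ℝ G c v = inner ℝ gs v.1 + inner ℝ gp v.2) :
    canonicalBracket F G c = fderiv ℝ F c (gp, -gs) := by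
  have h_sum (L : Eu d →L[ℝ] ℝ) (g : Eu d) : L g = ∑ i, L (EuclideanSpace.single i 1) * g i := by
    conv_lhs => rw [← (EuclideanSpace.basisFun (Fin d) ℝ).sum_repr g]
    simp [mul_comm]
  have h_split : fderiv ℝ F c (gp, -gs) =
      (fderiv ℝ F c ∘L .inl ℝ _ _) gp - (fderiv ℝ F c ∘L .inr ℝ _ _) gs := by
    simp [← map_sub]
  rw [h_split, h_sum, h_sum, ← Finset.sum_sub_distrib]
  refine Finset.sum_congr rfl fun i _ => ?_
  simp [hG, EuclideanSpace.inner_single_right]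

/-- The passage from the canonical coordinates of `Tℍ^d` to the normalized chart. -/
def chartMap (a : ℝ) (e : Eu d) (c : Eu d × Eu d) : Eu d × Eu d :=
  normChart a e (ofCanonical c)

lemma chartMap_eq (a : ℝ) (e : Eu d) (c : Eu d × Eu d) : chartMap a e c =
    (axisScale (√(1 - a ^ 2))⁻¹ e ((√(1 + ‖c.1‖ ^ 2))⁻¹ • c.1) + signedHalfDist a • e,
      axisScale (√(1 - a ^ 2))⁻¹ e (√(1 + ‖c.1‖ ^ 2) • c.2)) := by
  refine Prod.ext rfl (congrArg (axisScale (√(1 - a ^ 2))⁻¹ e) ?_)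
  simp only [chartVel, ofCanonical]
  module

lemma contDiff_chartMap (a : ℝ) (e : Eu d) : ContDiff ℝ 1 (chartMap a e) := by
  have h_sqrt : ContDiff ℝ 1 (fun c : Eu d × Eu d => √(1 + ‖c.1‖ ^ 2)) :=
    (contDiff_const.add (contDiff_fst.norm_sq ℝ)).sqrt fun c => by positivity
  have h_ne (c : Eu d × Eu d) : √(1 + ‖c.1‖ ^ 2) ≠ 0 := by positivity
  rw [funext (chartMap_eq a e)]
  fun_prop (disch := assumption)

lemma fderiv_chartMap (a : ℝ) (e : Eu d) (c v : Eu d × Eu d) :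
    fderiv ℝ (chartMap a e) c v =
      (axisScale (√(1 - a ^ 2))⁻¹ e ((√(1 + ‖c.1‖ ^ 2))⁻¹ • v.1
          - (inner ℝ c.1 v.1 / √(1 + ‖c.1‖ ^ 2) ^ 3) • c.1),
        axisScale (√(1 - a ^ 2))⁻¹ e ((inner ℝ c.1 v.1 / √(1 + ‖c.1‖ ^ 2)) • c.2
          + √(1 + ‖c.1‖ ^ 2) • v.2)) := by
  have h_diff := (contDiff_chartMap a e).differentiable one_ne_zero c
  rw [← h_diff.lineDeriv_eq_fderiv]
  refine HasDerivAt.deriv ?_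
  have h_s := hasDerivAt_add_smul c.1 v.1
  have h_sqrt := (h_s.norm_sq.const_add 1).sqrt (by positivity)
  have h_pos := (axisScale (√(1 - a ^ 2))⁻¹ e).hasFDerivAt.comp_hasDerivAt (0 : ℝ)
    ((h_sqrt.fun_inv (by positivity)).fun_smul h_s)
  have h_vel := (axisScale (√(1 - a ^ 2))⁻¹ e).hasFDerivAt.comp_hasDerivAt (0 : ℝ)
    (h_sqrt.fun_smul (hasDerivAt_add_smul c.2 v.2))
  simp only [chartMap_eq]
  refine ((h_pos.add_const (signedHalfDist a • e)).prodMk h_vel).congr_deriv ?_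
  have h_ne : √(1 + ‖c.1‖ ^ 2) ≠ 0 := by positivity
  simp only [zero_smul, add_zero]
  ext1 <;> dsimp only <;> congr 1 <;> match_scalars <;> field_simp

lemma axisScale_inv_axisScale_inv (ha : a ^ 2 < 1) (he : ‖e‖ = 1) (v : Eu d) :
    axisScale (√(1 - a ^ 2))⁻¹ e (axisScale (√(1 - a ^ 2))⁻¹ e v) =
      v + (signedHalfDist a ^ 2 * inner ℝ v e) • e := by
  have hb : 1 - a ^ 2 ≠ 0 := by linarith
  rw [axisScale_axisScale he, axisScale_apply, ← mul_inv, Real.mul_self_sqrt (by linarith),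
    signedHalfDist, neg_sq, div_pow, Real.sq_sqrt (by linarith)]
  congr 3
  field_simp
  ring

/-- The adjoint of the derivative of `chartMap`. -/
def chartMapAdjoint (a : ℝ) (e : Eu d) (c k : Eu d × Eu d) : Eu d × Eu d :=
  ((√(1 + ‖c.1‖ ^ 2))⁻¹ • axisScale (√(1 - a ^ 2))⁻¹ e k.1
      + (inner ℝ k.2 (axisScale (√(1 - a ^ 2))⁻¹ e c.2) / √(1 + ‖c.1‖ ^ 2)
        - inner ℝ c.1 (axisScale (√(1 - a ^ 2))⁻¹ e k.1) / √(1 + ‖c.1‖ ^ 2) ^ 3) • c.1,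
    √(1 + ‖c.1‖ ^ 2) • axisScale (√(1 - a ^ 2))⁻¹ e k.2)

lemma inner_fderiv_chartMap (a : ℝ) (e : Eu d) (c k v : Eu d × Eu d) :
    inner ℝ k.1 (fderiv ℝ (chartMap a e) c v).1 + inner ℝ k.2 (fderiv ℝ (chartMap a e) c v).2 =
      inner ℝ (chartMapAdjoint a e c k).1 v.1 + inner ℝ (chartMapAdjoint a e c k).2 v.2 := by
  simp only [fderiv_chartMap, chartMapAdjoint, inner_add_left, inner_add_right, inner_sub_right,
    real_inner_smul_left, real_inner_smul_right, map_add, map_sub, map_smul,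
    ← inner_axisScale_left, real_inner_comm _ c.1]
  field_simp
  ring

lemma fderiv_chartMap_adjoint (ha : a ^ 2 < 1) (he : ‖e‖ = 1) {c : Eu d × Eu d}
    (k : Eu d × Eu d) {p : Eu d} (hp : p = (chartMap a e c).1 - signedHalfDist a • e) :
    fderiv ℝ (chartMap a e) c ((chartMapAdjoint a e c k).2, -(chartMapAdjoint a e c k).1) =
      (chartCometric (signedHalfDist a) e p k.2,
        -chartCometric (signedHalfDist a) e p k.1 - (inner ℝ k.2 (chartMap a e c).2 : ℝ) • p
          + (inner ℝ p k.2 : ℝ) • (chartMap a e c).2) := by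
  have h_ne : √(1 + ‖c.1‖ ^ 2) ≠ 0 := by positivity
  rw [chartMap_eq, add_sub_cancel_right] at hp
  rw [fderiv_chartMap, chartMap_eq, hp]
  simp only [chartCometric, ← axisScale_inv_axisScale_inv ha he, chartMapAdjoint,
    real_inner_smul_left, real_inner_smul_right, inner_axisScale_left, map_add, map_sub, map_smul,
    map_neg]
  ext1 <;> match_scalars <;> field_simp
  ring

lemma canonicalBracket_comp_chartMap (ha : a ^ 2 < 1) (he : ‖e‖ = 1) (μ : ℝ)
    {F : Eu d × Eu d → ℝ} {c : Eu d × Eu d} (hc : (chartMap a e c).1 ≠ 0)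
    (hF : DifferentiableAt ℝ F (chartMap a e c)) :
    canonicalBracket (F ∘ chartMap a e) (chartD μ (signedHalfDist a) e ∘ chartMap a e) c =
      fderiv ℝ F (chartMap a e c) (hamField μ (signedHalfDist a) e (chartMap a e c)) := by
  have h_diff := (contDiff_chartMap a e).differentiable one_ne_zero c
  have h_D := hasFDerivAt_chartD μ (signedHalfDist a) e hc
  let k := (gradPos μ (signedHalfDist a) e (chartMap a e c),
    gradVel (signedHalfDist a) e (chartMap a e c))
  have h_grad (v : Eu d × Eu d) : fderiv ℝ (chartD μ (signedHalfDist a) e ∘ chartMap a e) c v =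
      inner ℝ (chartMapAdjoint a e c k).1 v.1 + inner ℝ (chartMapAdjoint a e c k).2 v.2 := by
    rw [fderiv_comp c h_D.differentiableAt h_diff, h_D.fderiv]
    exact inner_fderiv_chartMap a e c k v
  rw [canonicalBracket_eq_fderiv h_grad, fderiv_comp c hF h_diff,
    ContinuousLinearMap.comp_apply, fderiv_chartMap_adjoint ha he _ rfl, hamField]

lemma D_eq_chartD (ha : a ^ 2 < 1) (he : ‖e‖ = 1) (m : ℝ) (z : Mink d × Mink d) :
    D m a e z = chartD (m / √(1 - a ^ 2)) (signedHalfDist a) e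
      (normChartPos a e z.1, normChartVel a e z) := by
  have h_ne := (sqrt_one_sub_sq_pos ha).ne'
  have h_pos : axisScale (√(1 - a ^ 2))⁻¹ e (chartPos z - a • e) = normChartPos a e z.1 := by
    rw [normChartPos, chartPos, map_sub, map_smul (axisScale (√(1 - a ^ 2))⁻¹ e) a,
      axisScale_self he, signedHalfDist]
    module
  have h_axis : axisScale (√(1 - a ^ 2))⁻¹ e (-√(1 - a ^ 2) • e) = -e := by
    rw [map_smul, axisScale_self he, smul_smul, neg_mul, mul_inv_cancel₀ h_ne, neg_one_smul]
  rw [D, angMomSq, lrl, normChartVel]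
  simp only [affInner_eq_inner_axisScale ha he, h_axis, h_pos, map_sub, map_smul,
    real_inner_self_eq_norm_sq, Real.sqrt_sq (norm_nonneg _), inner_neg_right,
    inner_sub_left, real_inner_smul_left, chartD, signedHalfDist]
  ring

lemma D_comp_ofCanonical (ha : a ^ 2 < 1) (he : ‖e‖ = 1) (m : ℝ) :
    D m a e ∘ ofCanonical = chartD (m / √(1 - a ^ 2)) (signedHalfDist a) e ∘ chartMap a e :=
  funext fun c => D_eq_chartD ha he m (ofCanonical c)

end Bracket

section Energy

variable {d : ℕ} {a : ℝ} {e : Eu d}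

lemma mink_ofCanonical_snd (c : Eu d × Eu d) :
    mink (ofCanonical c).2 (ofCanonical c).2 = ‖c.2‖ ^ 2 + inner ℝ c.1 c.2 ^ 2 := by
  have h_sq : √(1 + ‖c.1‖ ^ 2) ^ 2 = 1 + ‖c.1‖ ^ 2 := Real.sq_sqrt (by positivity)
  simp only [mink, ofCanonical, inner_add_left, inner_add_right, real_inner_smul_left,
    real_inner_smul_right, real_inner_self_eq_norm_sq c.1, real_inner_self_eq_norm_sq c.2,
    real_inner_comm c.1 c.2]
  linear_combination -(inner ℝ c.1 c.2 : ℝ) ^ 2 * h_sq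

lemma axisScale_chartMap_sub (ha : a ^ 2 < 1) (he : ‖e‖ = 1) (c : Eu d × Eu d) :
    axisScale (√(1 - a ^ 2)) e ((chartMap a e c).1 - signedHalfDist a • e) =
      (√(1 + ‖c.1‖ ^ 2))⁻¹ • c.1 :=
  axisScale_normChartPos_sub ha he (ofCanonical c).1

lemma axisScale_chartMap_snd (ha : a ^ 2 < 1) (he : ‖e‖ = 1) (c : Eu d × Eu d) :
    axisScale (√(1 - a ^ 2)) e (chartMap a e c).2 = √(1 + ‖c.1‖ ^ 2) • c.2 := by
  rw [chartMap_eq, axisScale_axisScale he, mul_inv_cancel₀ (sqrt_one_sub_sq_pos ha).ne',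
    axisScale_one]

lemma norm_snd_sq_eq_chartMap (ha : a ^ 2 < 1) (he : ‖e‖ = 1) (c : Eu d × Eu d) :
    ‖c.2‖ ^ 2 = confFactor a e (chartMap a e c).1 *
      (‖(chartMap a e c).2‖ ^ 2 - a ^ 2 * inner ℝ (chartMap a e c).2 e ^ 2) := by
  have h_norm := norm_axisScale_sq he (√(1 - a ^ 2)) (chartMap a e c).2
  have h_conf : (1 + ‖c.1‖ ^ 2) * confFactor a e (chartMap a e c).1 = 1 := by
    rw [← Real.sq_sqrt (by positivity : 0 ≤ 1 + ‖c.1‖ ^ 2)]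
    exact snd_sq_mul_confFactor ha he (ofCanonical_mem c).1
  rw [axisScale_chartMap_snd ha he, norm_smul, mul_pow, Real.norm_eq_abs, sq_abs,
    Real.sq_sqrt (by positivity), Real.sq_sqrt (by linarith)] at h_norm
  linear_combination -‖c.2‖ ^ 2 * h_conf + confFactor a e (chartMap a e c).1 * h_norm

lemma inner_fst_snd_eq_chartMap (ha : a ^ 2 < 1) (he : ‖e‖ = 1) (c : Eu d × Eu d) :
    inner ℝ c.1 c.2 = inner ℝ (chartMap a e c).1 (chartMap a e c).2
      - signedHalfDist a * inner ℝ (chartMap a e c).2 e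
      - a ^ 2 * (inner ℝ (chartMap a e c).1 e - signedHalfDist a)
        * inner ℝ (chartMap a e c).2 e := by
  have h_ne : √(1 + ‖c.1‖ ^ 2) ≠ 0 := by positivity
  have h_inner := inner_axisScale he (√(1 - a ^ 2))
    ((chartMap a e c).1 - signedHalfDist a • e) (chartMap a e c).2
  rw [axisScale_chartMap_snd ha he, axisScale_chartMap_sub ha he, Real.sq_sqrt (by linarith),
    real_inner_smul_left, real_inner_smul_right, inv_mul_cancel_left₀ h_ne, inner_sub_left,
    inner_sub_left, real_inner_smul_left, real_inner_smul_left, real_inner_self_eq_norm_sq, he,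
    real_inner_comm _ e] at h_inner
  rw [h_inner]
  ring

lemma keplerEnergy_ofCanonical (ha : a ^ 2 < 1) (he : ‖e‖ = 1) (m : ℝ) {c : Eu d × Eu d}
    (hc : (chartMap a e c).1 ≠ 0) :
    keplerEnergy m (lift (a • e)) (ofCanonical c) =
      chartEnergy (m / √(1 - a ^ 2)) (signedHalfDist a) e (chartMap a e c) := by
  have h_norm := norm_ne_zero_iff.2 hc
  have h_sqrt := (sqrt_one_sub_sq_pos ha).ne'
  have h_one_add : 1 + signedHalfDist a ^ 2 ≠ 0 := by positivity
  have h_one_sub : 1 - a ^ 2 = (1 + signedHalfDist a ^ 2)⁻¹ :=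
    eq_inv_of_mul_eq_one_right (one_add_signedHalfDist_sq_mul ha)
  have h_sq : a ^ 2 = signedHalfDist a ^ 2 / (1 + signedHalfDist a ^ 2) := by
    field_simp
    linear_combination -one_add_signedHalfDist_sq_mul ha
  have h_mass : m * √(1 - a ^ 2) = m / √(1 - a ^ 2) * (1 + signedHalfDist a ^ 2)⁻¹ := by
    rw [← h_one_sub]
    field_simp
    rw [Real.sq_sqrt (by linarith)]
  rw [keplerEnergy, keplerPot_first ha he m (ofCanonical_mem c).1, mink_ofCanonical_snd,
    norm_snd_sq_eq_chartMap ha he, inner_fst_snd_eq_chartMap ha he, h_mass]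
  change _ = chartEnergy _ _ _ (chartMap a e c)
  change (_ : ℝ) + -(_ * (1 + _ * inner ℝ (chartMap a e c).1 e) / ‖(chartMap a e c).1‖) = _
  generalize m / √(1 - a ^ 2) = μ
  generalize chartMap a e c = z at *
  simp only [confFactor, chartFactor, chartEnergy, freqSq, chartD, perpAngMomSq,
    inner_perp_perp he, ← real_inner_self_eq_norm_sq (perp e _), real_inner_self_eq_norm_sq,
    h_sq]
  field_simp
  ring

end Energy

/-! ### Solutions of the Kepler problem up to a change of time -/

section TimeChange

/-- `u` is the inverse of a primitive of `g`, and `T` is the integral of `g` over a period. -/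
lemma exists_inverse_primitive {g : ℝ → ℝ} {p : ℝ} (hp : 0 < p) (hg : Continuous g)
    (g_pos : ∀ u, 0 < g u) (g_periodic : Function.Periodic g p) :
    ∃ (u : ℝ → ℝ) (T : ℝ), 0 < T ∧ u 0 = 0 ∧ (∀ t, HasDerivAt u (g (u t))⁻¹ t) ∧
      ∀ t, u (t + T) = u t + p := by
  set τ : ℝ → ℝ := fun u => ∫ s in (0 : ℝ)..u, g s with hτ
  have τ_deriv : ∀ u, HasDerivAt τ (g u) u := fun u =>
    (hg.integral_hasStrictDerivAt 0 u).hasDerivAt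
  have τ_mono : StrictMono τ := strictMono_of_deriv_pos fun u => by
    simpa only [(τ_deriv u).deriv] using g_pos u
  have τ_zero : τ 0 = 0 := intervalIntegral.integral_same
  have τ_period_pos : 0 < τ p := τ_zero ▸ τ_mono hp
  have τ_surjective : Function.Surjective τ :=
    (continuous_iff_continuousAt.2 fun u => (τ_deriv u).continuousAt).surjective
      (g_periodic.tendsto_atTop_intervalIntegral_of_pos τ_period_pos hp)
      (g_periodic.tendsto_atBot_intervalIntegral_of_pos τ_period_pos hp)
  have τ_add : ∀ u, τ (u + p) = τ u + τ p := fun u => by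
    simp only [hτ]
    rw [← intervalIntegral.integral_add_adjacent_intervals (hg.intervalIntegrable 0 u)
      (hg.intervalIntegrable u (u + p)), g_periodic.intervalIntegral_add_eq u 0, zero_add]
  set φ := StrictMono.orderIsoOfSurjective τ τ_mono τ_surjective
  have τ_symm : ∀ t, τ (φ.symm t) = t := φ.apply_symm_apply
  refine ⟨φ.symm, τ p, τ_period_pos, τ_mono.injective ?_, fun t => ?_,
    fun t => τ_mono.injective ?_⟩
  · rw [τ_symm, τ_zero]
  · exact HasDerivAt.of_local_left_inverse φ.symm.continuous.continuousAt (τ_deriv _)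
      (g_pos _).ne' (Filter.Eventually.of_forall τ_symm)
  · rw [τ_symm, τ_add, τ_symm]

lemma eq_of_hasDerivAt_zero {F : Type*} [NormedAddCommGroup F] [NormedSpace ℝ F] {f : ℝ → F}
    (hf : ∀ t, HasDerivAt f 0 t) (s t : ℝ) : f s = f t :=
  is_const_of_deriv_eq_zero (fun t => (hf t).differentiableAt) (fun t => (hf t).deriv) s t

end TimeChange

section Motion

variable {E : Type*} [NormedAddCommGroup E] [InnerProductSpace ℝ E]

lemma cos_eq_one_of_ellipse_eq {y η : E} {u : ℝ} (hy : y ≠ 0) (h_pos : ellipse y η u = y)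
    (h_vel : ellipseVel y η u = η) : Real.cos u = 1 := by
  by_contra h_cos
  have h_cos' : 1 - Real.cos u ≠ 0 := sub_ne_zero.2 (Ne.symm h_cos)
  have h_sum : (1 - Real.cos u) ^ 2 + Real.sin u ^ 2 = 2 * (1 - Real.cos u) := by
    linear_combination Real.sin_sq_add_cos_sq u
  have h_zero : ∀ v : E, (2 * (1 - Real.cos u)) • v = 0 → v = 0 := fun v hv =>
    (smul_eq_zero.1 hv).resolve_left (mul_ne_zero two_ne_zero h_cos')
  have hη : η = 0 := h_zero η <| by
    have h : ((1 - Real.cos u) ^ 2 + Real.sin u ^ 2) • η =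
        Real.sin u • (ellipse y η u - y) - (1 - Real.cos u) • (ellipseVel y η u - η) := by
      rw [ellipse, ellipseVel]
      module
    rw [← h_sum, h, h_pos, h_vel, sub_self, sub_self, smul_zero, smul_zero, sub_zero]
  have h_center : ellipseCenter y η - y = 0 := h_zero _ <| by
    have h : ((1 - Real.cos u) ^ 2 + Real.sin u ^ 2) • (ellipseCenter y η - y) =
        (1 - Real.cos u) • (ellipse y η u - y) + Real.sin u • (ellipseVel y η u - η) := by
      rw [ellipse, ellipseVel]
      module
    rw [← h_sum, h, h_pos, h_vel, sub_self, sub_self, smul_zero, smul_zero, add_zero]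
  have h_half : ellipseCenter y η = (1 / 2 : ℝ) • y := by
    rw [hη, ellipseCenter, semiMajorAxis, norm_zero, inner_zero_right]
    match_scalars
    field_simp
    ring
  refine hy ?_
  rw [show y = (-2 : ℝ) • ((1 / 2 : ℝ) • y - y) by module, ← h_half, h_center, smul_zero]

/-- `y` and `w` are the position and the velocity of a solution of the Kepler problem of mass `μ`
in a time whose element is `N` times that of the time parameter. -/
structure IsChartMotion (μ : ℝ) (N : ℝ → ℝ) (y w : ℝ → E) : Prop where
  ne_zero : ∀ t, y t ≠ 0
  factor_pos : ∀ t, 0 < N t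
  factor_continuous : Continuous N
  hasDerivAt_pos : ∀ t, HasDerivAt y (N t • w t) t
  hasDerivAt_vel : ∀ t, HasDerivAt w (-(N t * μ / ‖y t‖ ^ 3) • y t) t

/-- The eccentric anomaly of a Kepler motion as a function of time. -/
def anomaly (μ : ℝ) (N : ℝ → ℝ) (y w : ℝ → E) (t : ℝ) : ℝ :=
  ∫ s in (0 : ℝ)..t, √(freqSq μ (y 0, w 0)) * N s / ‖y s‖

namespace IsChartMotion

variable {μ T : ℝ} {N : ℝ → ℝ} {y w : ℝ → E}

lemma continuous_pos (hm : IsChartMotion μ N y w) : Continuous y :=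
  continuous_iff_continuousAt.2 fun t => (hm.hasDerivAt_pos t).continuousAt

lemma norm_pos (hm : IsChartMotion μ N y w) (t : ℝ) : 0 < ‖y t‖ := norm_pos_iff.2 (hm.ne_zero t)

lemma freqSq_eq (hm : IsChartMotion μ N y w) (t : ℝ) :
    freqSq μ (y t, w t) = freqSq μ (y 0, w 0) := by
  refine eq_of_hasDerivAt_zero (f := fun t => freqSq μ (y t, w t)) (fun t => ?_) t 0
  have hr := (hm.norm_pos t).ne'
  refine (((hasDerivAt_const t (2 * μ)).fun_div
    (hasDerivAt_norm_comp (hm.hasDerivAt_pos t) (hm.ne_zero t)) hr).fun_sub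
    (hm.hasDerivAt_vel t).norm_sq).congr_deriv ?_
  simp only [real_inner_smul_right, real_inner_comm (y t) (w t)]
  field_simp
  ring

/-- Without a bounded orbit, `⟪y, w⟫` would be strictly increasing by the virial identity. -/
lemma freqSq_pos (hm : IsChartMotion μ N y w) (hμ : 0 < μ) (hT : 0 < T) (hy : y T = y 0)
    (hw : w T = w 0) : 0 < freqSq μ (y 0, w 0) := by
  by_contra! h_freq
  have h_virial : ∀ t, HasDerivAt (fun t => (inner ℝ (y t) (w t) : ℝ))
      (N t * (μ / ‖y t‖ - freqSq μ (y 0, w 0))) t := fun t => by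
    have hr := (hm.norm_pos t).ne'
    refine ((hm.hasDerivAt_pos t).inner ℝ (hm.hasDerivAt_vel t)).congr_deriv ?_
    rw [real_inner_smul_right, real_inner_smul_left, real_inner_self_eq_norm_sq,
      real_inner_self_eq_norm_sq, ← hm.freqSq_eq t, freqSq]
    field_simp
    ring
  have h_mono : StrictMono fun t => (inner ℝ (y t) (w t) : ℝ) :=
    strictMono_of_deriv_pos fun t => by
      rw [(h_virial t).deriv]
      have := div_pos hμ (hm.norm_pos t)
      exact mul_pos (hm.factor_pos t) (by linarith)
  have h_lt := h_mono hT
  simp only [hy, hw, lt_self_iff_false] at h_lt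

lemma ellipseCenter_eq (hm : IsChartMotion μ N y w) (hf : 0 < freqSq μ (y 0, w 0)) (t : ℝ) :
    ellipseCenter (y t) (anomVel μ (y t, w t)) = ellipseCenter (y 0) (anomVel μ (y 0, w 0)) := by
  have hf' : 0 < freqSq μ (y t, w t) := by rwa [hm.freqSq_eq]
  rw [ellipseCenter_anomVel (z := (y t, w t)) (hm.ne_zero t) hf',
    ellipseCenter_anomVel (z := (y 0, w 0)) (hm.ne_zero 0) hf, hm.freqSq_eq t]
  refine congrArg _ (eq_of_hasDerivAt_zero
    (f := fun t => inner ℝ (y t) (w t) • w t - (‖w t‖ ^ 2 - μ / ‖y t‖) • y t)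
    (fun t => ?_) t 0)
  have hr := (hm.norm_pos t).ne'
  have hy := hm.hasDerivAt_pos t
  have hw := hm.hasDerivAt_vel t
  refine (((hy.inner ℝ hw).fun_smul hw).fun_sub ((hw.norm_sq.fun_sub ((hasDerivAt_const t μ).fun_div
    (hasDerivAt_norm_comp hy (hm.ne_zero t)) hr)).fun_smul hy)).congr_deriv ?_
  simp only [real_inner_smul_right, real_inner_smul_left, real_inner_comm (y t) (w t),
    real_inner_self_eq_norm_sq]
  rw [← sub_eq_zero]
  match_scalars <;> field_simp <;> ring

section Anomaly

omit [InnerProductSpace ℝ E] in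
lemma anomaly_zero (μ : ℝ) (N : ℝ → ℝ) (y w : ℝ → E) : anomaly μ N y w 0 = 0 :=
  intervalIntegral.integral_same

lemma continuous_anomaly_integrand (hm : IsChartMotion μ N y w) :
    Continuous fun s => √(freqSq μ (y 0, w 0)) * N s / ‖y s‖ :=
  (continuous_const.mul hm.factor_continuous).div hm.continuous_pos.norm
    fun s => (hm.norm_pos s).ne'

lemma hasDerivAt_anomaly (hm : IsChartMotion μ N y w) (t : ℝ) :
    HasDerivAt (anomaly μ N y w) (√(freqSq μ (y 0, w 0)) * N t / ‖y t‖) t :=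
  (hm.continuous_anomaly_integrand.integral_hasStrictDerivAt 0 t).hasDerivAt

lemma strictMono_anomaly (hm : IsChartMotion μ N y w) (hf : 0 < freqSq μ (y 0, w 0)) :
    StrictMono (anomaly μ N y w) :=
  strictMono_of_deriv_pos fun t => by
    rw [(hm.hasDerivAt_anomaly t).deriv]
    exact div_pos (mul_pos (Real.sqrt_pos.2 hf) (hm.factor_pos t)) (hm.norm_pos t)

lemma hasDerivAt_pos_anomVel (hm : IsChartMotion μ N y w) (hf : 0 < freqSq μ (y 0, w 0)) (t : ℝ) :
    HasDerivAt y ((√(freqSq μ (y 0, w 0)) * N t / ‖y t‖) • anomVel μ (y t, w t)) t := by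
  have hr := (hm.norm_pos t).ne'
  have h_sqrt := (Real.sqrt_pos.2 hf).ne'
  refine (hm.hasDerivAt_pos t).congr_deriv ?_
  rw [anomVel, hm.freqSq_eq t, smul_smul]
  congr 1
  field_simp

lemma hasDerivAt_anomVel (hm : IsChartMotion μ N y w) (hf : 0 < freqSq μ (y 0, w 0)) (t : ℝ) :
    HasDerivAt (fun t => anomVel μ (y t, w t)) ((√(freqSq μ (y 0, w 0)) * N t / ‖y t‖) •
      (ellipseCenter (y 0) (anomVel μ (y 0, w 0)) - y t)) t := by
  have hr := (hm.norm_pos t).ne'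
  have hf' : 0 < freqSq μ (y t, w t) := by rwa [hm.freqSq_eq]
  have h_sqrt := (Real.sqrt_pos.2 hf).ne'
  have h_sq := Real.sq_sqrt hf.le
  have h_speed : ‖w t‖ ^ 2 = 2 * μ / ‖y t‖ - √(freqSq μ (y 0, w 0)) ^ 2 := by
    rw [h_sq, ← hm.freqSq_eq t, freqSq]
    ring
  rw [← hm.ellipseCenter_eq hf t, ellipseCenter_anomVel (z := (y t, w t)) (hm.ne_zero t) hf']
  simp only [anomVel, hm.freqSq_eq]
  refine (((hasDerivAt_norm_comp (hm.hasDerivAt_pos t) (hm.ne_zero t)).div_const _).fun_smul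
    (hm.hasDerivAt_vel t)).congr_deriv ?_
  generalize √(freqSq μ (y 0, w 0)) = ω at *
  rw [← h_sq, h_speed, real_inner_smul_right]
  match_scalars <;> field_simp
  ring

/-- The difference of the two sides satisfies the equations of a harmonic oscillator in the
eccentric anomaly and vanishes initially, hence its energy is zero at all times. -/
lemma eq_orbit_anomaly (hm : IsChartMotion μ N y w) (hf : 0 < freqSq μ (y 0, w 0)) (t : ℝ) :
    y t = orbit μ (y 0, w 0) (anomaly μ N y w t) ∧
      anomVel μ (y t, w t) = orbitVel μ (y 0, w 0) (anomaly μ N y w t) := by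
  set Δy := fun t => y t - orbit μ (y 0, w 0) (anomaly μ N y w t) with hΔy
  set Δη := fun t => anomVel μ (y t, w t) - orbitVel μ (y 0, w 0) (anomaly μ N y w t) with hΔη
  set u' := fun t => √(freqSq μ (y 0, w 0)) * N t / ‖y t‖
  have h_pos : ∀ t, HasDerivAt Δy (u' t • Δη t) t := fun t =>
    ((hm.hasDerivAt_pos_anomVel hf t).sub ((hasDerivAt_orbit _ _ _).scomp t
      (hm.hasDerivAt_anomaly t))).congr_deriv (smul_sub _ _ _).symm
  have h_vel : ∀ t, HasDerivAt Δη (-u' t • Δy t) t := fun t => by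
    refine ((hm.hasDerivAt_anomVel hf t).sub ((hasDerivAt_ellipseVel _ _ _).scomp t
      (hm.hasDerivAt_anomaly t))).congr_deriv ?_
    simp only [hΔy, orbit]
    module
  have h_energy : ‖Δy t‖ ^ 2 + ‖Δη t‖ ^ 2 = ‖Δy 0‖ ^ 2 + ‖Δη 0‖ ^ 2 :=
    eq_of_hasDerivAt_zero (f := fun t => ‖Δy t‖ ^ 2 + ‖Δη t‖ ^ 2) (fun t => by
      refine ((h_pos t).norm_sq.add (h_vel t).norm_sq).congr_deriv ?_
      rw [real_inner_smul_right, real_inner_smul_right, real_inner_comm]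
      ring) t 0
  have h_zero : Δy 0 = 0 ∧ Δη 0 = 0 := by
    simp [hΔy, hΔη, anomaly_zero, orbit, orbitVel, ellipse_zero, ellipseVel_zero]
  rw [h_zero.1, h_zero.2] at h_energy
  have h_norms : ‖Δy t‖ = 0 ∧ ‖Δη t‖ = 0 := by
    constructor <;> nlinarith [norm_nonneg (Δy t), norm_nonneg (Δη t), norm_zero (E := E)]
  exact ⟨sub_eq_zero.1 (norm_eq_zero.1 h_norms.1), sub_eq_zero.1 (norm_eq_zero.1 h_norms.2)⟩

lemma exists_anomaly_period (hm : IsChartMotion μ N y w) (hμ : 0 < μ) (hT : 0 < T)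
    (hy : y T = y 0) (hw : w T = w 0) :
    ∃ n : ℕ, 0 < n ∧ anomaly μ N y w T = n * (2 * Real.pi) := by
  have hf := hm.freqSq_pos hμ hT hy hw
  obtain ⟨h_pos, h_vel⟩ := hm.eq_orbit_anomaly hf T
  rw [hy] at h_pos
  rw [hy, hw] at h_vel
  obtain ⟨n, hn⟩ := (Real.cos_eq_one_iff _).1
    (cos_eq_one_of_ellipse_eq (hm.ne_zero 0) h_pos.symm h_vel.symm)
  have h_anomaly : 0 < anomaly μ N y w T := anomaly_zero μ N y w ▸ hm.strictMono_anomaly hf hT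
  have n_pos : 0 < n := by
    rw [← hn] at h_anomaly
    exact_mod_cast pos_of_mul_pos_left h_anomaly Real.two_pi_pos.le
  lift n to ℕ using n_pos.le
  exact ⟨n, by exact_mod_cast n_pos, by exact_mod_cast hn.symm⟩

lemma exists_orbit_eq (hm : IsChartMotion μ N y w) (hμ : 0 < μ) (hT : 0 < T)
    (hy : y T = y 0) (hw : w T = w 0) (u : ℝ) : ∃ t, orbit μ (y 0, w 0) u = y t := by
  have hf := hm.freqSq_pos hμ hT hy hw
  obtain ⟨n, n_pos, hn⟩ := hm.exists_anomaly_period hμ hT hy hw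
  obtain ⟨v, hv, huv⟩ := (ellipse_periodic (y 0) (anomVel μ (y 0, w 0))).exists_mem_Ico₀
    Real.two_pi_pos u
  have h_period : 2 * Real.pi ≤ anomaly μ N y w T := by
    rw [hn]
    exact le_mul_of_one_le_left Real.two_pi_pos.le (by exact_mod_cast n_pos)
  obtain ⟨t, -, ht⟩ := intermediate_value_Icc hT.le
    (fun t _ => (hm.hasDerivAt_anomaly t).continuousAt.continuousWithinAt)
    (show v ∈ Set.Icc (anomaly μ N y w 0) (anomaly μ N y w T) from
      ⟨(anomaly_zero μ N y w).trans_le hv.1, hv.2.le.trans h_period⟩)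
  exact ⟨t, huv.trans (by rw [(hm.eq_orbit_anomaly hf t).1, ht]; rfl)⟩

/-- The factor `K` does not depend on `V`, hence it cancels in time averages. -/
lemma exists_integral_eq_mul_orbitIntegral {P : E → ℝ}
    (hm : IsChartMotion μ (fun t => P (y t)) y w) (hμ : 0 < μ) (hT : 0 < T) (hy : y T = y 0)
    (hw : w T = w 0) (hP : Continuous fun u => P (orbit μ (y 0, w 0) u)) :
    ∃ K : ℝ, K ≠ 0 ∧ ∀ V : E → ℝ, (Continuous fun u => V (orbit μ (y 0, w 0) u)) →
      ∫ t in (0 : ℝ)..T, V (y t) =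
        K * orbitIntegral μ (fun y => ‖y‖ / P y * V y) (y 0, w 0) := by
  have hf := hm.freqSq_pos hμ hT hy hw
  obtain ⟨n, n_pos, hn⟩ := hm.exists_anomaly_period hμ hT hy hw
  refine ⟨n * (√(freqSq μ (y 0, w 0)))⁻¹, by positivity, fun V hV => ?_⟩
  set Y := orbit μ (y 0, w 0)
  have P_ne : ∀ u, P (Y u) ≠ 0 := fun u => by
    obtain ⟨t, ht⟩ := hm.exists_orbit_eq hμ hT hy hw u
    simpa only [Y, ht] using (hm.factor_pos t).ne'
  set g : ℝ → ℝ := fun u => ‖Y u‖ / P (Y u) * V (Y u) with hg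
  have g_continuous : Continuous g := ((continuous_orbit _ _).norm.div hP P_ne).mul hV
  have g_periodic : Function.Periodic g (2 * Real.pi) :=
    (ellipse_periodic _ _).comp fun y => ‖y‖ / P y * V y
  calc ∫ t in (0 : ℝ)..T, V (y t)
      = ∫ t in (0 : ℝ)..T, ((fun u => (√(freqSq μ (y 0, w 0)))⁻¹ * g u) ∘
          anomaly μ (fun t => P (y t)) y w) t * (√(freqSq μ (y 0, w 0)) * P (y t) / ‖y t‖) := by
        refine intervalIntegral.integral_congr fun t _ => ?_
        have hr := (hm.norm_pos t).ne'
        have hPt := (hm.factor_pos t).ne'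
        simp only [Function.comp, hg, Y, ← (hm.eq_orbit_anomaly hf t).1]
        field_simp
    _ = ∫ u in (0 : ℝ)..n * (2 * Real.pi), (√(freqSq μ (y 0, w 0)))⁻¹ * g u := by
        rw [intervalIntegral.integral_comp_mul_deriv
          (g := fun u => (√(freqSq μ (y 0, w 0)))⁻¹ * g u) (fun t _ => hm.hasDerivAt_anomaly t)
          hm.continuous_anomaly_integrand.continuousOn (continuous_const.mul g_continuous),
          anomaly_zero, hn]
    _ = n * (√(freqSq μ (y 0, w 0)))⁻¹ * ∫ u in (0 : ℝ)..2 * Real.pi, g u := by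
        have h := g_periodic.intervalIntegral_add_zsmul_eq n 0 g_continuous.intervalIntegrable
        simp only [zero_add, zsmul_eq_mul, Int.cast_natCast] at h
        rw [intervalIntegral.integral_const_mul, h]
        ring

end Anomaly

end IsChartMotion

/-- Newton's equation: if `u` is the eccentric anomaly as a function of time, the function that is
differentiated is the velocity of the Kepler motion. -/
lemma hasDerivAt_div_smul_orbitVel {μ : ℝ} {z : E × E} (hf : 0 < freqSq μ z)
    (hz : ∀ u, orbit μ z u ≠ 0) {u : ℝ → ℝ} {t N : ℝ}
    (hu : HasDerivAt u (√(freqSq μ z) * N / ‖orbit μ z (u t)‖) t) :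
    HasDerivAt (fun s => (√(freqSq μ z) / ‖orbit μ z (u s)‖) • orbitVel μ z (u s))
      (-(N * μ / ‖orbit μ z (u t)‖ ^ 3) • orbit μ z (u t)) t := by
  have hy := fst_ne_zero_of_orbit_ne_zero hz
  have hr := norm_ne_zero_iff.2 (hz (u t))
  have h_newton : ‖orbit μ z (u t)‖ • (ellipseCenter z.1 (anomVel μ z) - orbit μ z (u t)) -
      focalRadiusVel z.1 (anomVel μ z) (u t) • orbitVel μ z (u t) =
        -(μ / freqSq μ z) • orbit μ z (u t) := by
    rw [norm_orbit hz, ← semiMajorAxis_anomVel hy hf]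
    exact ellipse_newton hy (anomVel μ z) (u t)
  have h_radius : HasDerivAt (fun s => ‖orbit μ z (u s)‖)
      (focalRadiusVel z.1 (anomVel μ z) (u t) * (√(freqSq μ z) * N / ‖orbit μ z (u t)‖)) t := by
    simp only [norm_orbit hz] at hu ⊢
    exact (hasDerivAt_focalRadius z.1 (anomVel μ z) (u t)).comp t hu
  have h_vel : HasDerivAt (fun s => orbitVel μ z (u s)) ((√(freqSq μ z) * N / ‖orbit μ z (u t)‖) •
      (ellipseCenter z.1 (anomVel μ z) - orbit μ z (u t))) t :=
    (hasDerivAt_ellipseVel z.1 (anomVel μ z) (u t)).scomp t hu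
  refine (((hasDerivAt_const t √(freqSq μ z)).fun_div h_radius hr).fun_smul h_vel).congr_deriv ?_
  have h_acc : -(N * μ / ‖orbit μ z (u t)‖ ^ 3) • orbit μ z (u t) =
      (N * √(freqSq μ z) ^ 2 / ‖orbit μ z (u t)‖ ^ 3) •
        (-(μ / freqSq μ z) • orbit μ z (u t)) := by
    rw [smul_smul, Real.sq_sqrt hf.le]
    congr 1
    field_simp
  rw [h_acc, ← h_newton]
  match_scalars <;> field_simp
  ring

lemma exists_isChartMotion {μ : ℝ} {z : E × E} (hf : 0 < freqSq μ z)
    (hz : ∀ u, orbit μ z u ≠ 0) {P : E → ℝ} (hP : Continuous fun u => P (orbit μ z u))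
    (P_pos : ∀ u, 0 < P (orbit μ z u)) :
    ∃ (y w : ℝ → E) (T : ℝ), 0 < T ∧ IsChartMotion μ (fun t => P (y t)) y w ∧ y 0 = z.1 ∧
      w 0 = z.2 ∧ Function.Periodic y T := by
  have hω := Real.sqrt_pos.2 hf
  set ω := √(freqSq μ z) with hω_def
  set Y := orbit μ z
  have Y_pos : ∀ u, 0 < ‖Y u‖ := fun u => norm_pos_iff.2 (hz u)
  have Y_periodic : Function.Periodic Y (2 * Real.pi) := ellipse_periodic _ _
  have Y_zero : Y 0 = z.1 := ellipse_zero
  obtain ⟨u, T, hT, u_zero, u_deriv, u_add⟩ := exists_inverse_primitive Real.two_pi_pos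
    (g := fun u => ‖Y u‖ / (ω * P (Y u)))
    ((continuous_orbit _ _).norm.div (continuous_const.mul hP)
      fun u => (mul_pos hω (P_pos u)).ne')
    (fun u => div_pos (Y_pos u) (mul_pos hω (P_pos u)))
    (Y_periodic.comp fun y => ‖y‖ / (ω * P y))
  simp only [inv_div] at u_deriv
  have u_continuous : Continuous u :=
    continuous_iff_continuousAt.2 fun t => (u_deriv t).continuousAt
  refine ⟨fun t => Y (u t), fun t => (ω / ‖Y (u t)‖) • orbitVel μ z (u t), T, hT,
    ⟨fun t => hz _, fun t => P_pos _, hP.comp u_continuous, fun t => ?_,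
      fun t => hasDerivAt_div_smul_orbitVel hf hz (u_deriv t)⟩, ?_, ?_, fun t => ?_⟩
  · refine ((hasDerivAt_orbit μ z (u t)).scomp t (u_deriv t)).congr_deriv ?_
    rw [smul_smul]
    congr 1
    ring
  · simp only [u_zero, Y_zero]
  · have hr := norm_ne_zero_iff.2 (fst_ne_zero_of_orbit_ne_zero hz)
    simp only [u_zero, Y_zero]
    rw [show orbitVel μ z 0 = anomVel μ z from ellipseVel_zero, anomVel, smul_smul, ← hω_def,
      div_mul_div_cancel₀ hr, div_self hω.ne', one_smul]
  · simp only [u_add, Y_periodic (u t)]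

end Motion

/-! ### Kepler motions in the normalized chart -/

section KeplerMotion

variable {d : ℕ} {a : ℝ} {e : Eu d}

lemma hasDerivAt_coth_arcosh {X : ℝ} (hX : 1 < X) :
    HasDerivAt (fun X => coth (Real.arcosh X)) (-(√(X ^ 2 - 1) ^ 3)⁻¹) X := by
  have h_pos : 0 < X ^ 2 - 1 := by nlinarith
  have h_sqrt := (Real.sqrt_pos.2 h_pos).ne'
  have h_sq : √(X ^ 2 - 1) ^ 2 = X ^ 2 - 1 := Real.sq_sqrt h_pos.le
  have h_eq : (fun X => coth (Real.arcosh X)) =ᶠ[nhds X] fun X => X / √(X ^ 2 - 1) :=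
    (eventually_ge_nhds hX).mono fun _ h => coth_arcosh h
  refine HasDerivAt.congr_of_eventuallyEq (((hasDerivAt_id X).div
    ((((hasDerivAt_id X).pow 2).sub_const 1).sqrt h_pos.ne') h_sqrt).congr_deriv ?_) h_eq
  simp only [id_eq, Pi.pow_apply]
  generalize √(X ^ 2 - 1) = S at *
  field_simp
  linear_combination 2 * h_sq

lemma fderiv_keplerPot (m : ℝ) (Z : Mink d) {q : Mink d} (hq : 1 < -mink q Z) (W : Mink d) :
    fderiv ℝ (keplerPot m Z) q W = -(m * mink W Z / √((-mink q Z) ^ 2 - 1) ^ 3) := by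
  have h_mink : HasFDerivAt (fun q : Mink d => -mink q Z) _ q :=
    (((hasFDerivAt_inner_const Z.1 q.1).comp q hasFDerivAt_fst).sub
      (hasFDerivAt_snd.mul_const Z.2)).fun_neg
  have h_coth : HasFDerivAt (fun q : Mink d => coth (hdist q Z)) _ q :=
    HasDerivAt.comp_hasFDerivAt (h₂ := fun X => coth (Real.arcosh X)) q
      (hasDerivAt_coth_arcosh hq) h_mink
  have h_pot : HasFDerivAt (keplerPot m Z) _ q :=
    (h_coth.const_mul m).fun_neg
  rw [h_pot.fderiv]
  simp only [mink, real_inner_comm Z.1, neg_smul, smul_neg, neg_neg, smul_apply, sub_apply,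
    smul_eq_mul, ContinuousLinearMap.comp_apply, ContinuousLinearMap.coe_fst',
    ContinuousLinearMap.coe_snd', coe_innerSL_apply, neg_apply]
  field_simp

lemma fderiv_keplerPot_first (ha : a ^ 2 < 1) (he : ‖e‖ = 1) (m : ℝ) {q : Mink d}
    (hq : q ∈ Hyp d) (hy : normChartPos a e q ≠ 0) {W : Mink d} (hW : mink q W = 0) :
    fderiv ℝ (keplerPot m (lift (a • e))) q W = (m / √(1 - a ^ 2)) *
      inner ℝ (axisScale (√(1 - a ^ 2)) e (normChartPos a e q)) W.1 /
        (q.2 * ‖normChartPos a e q‖) ^ 3 := by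
  have hq2 : 0 < q.2 := hq.2
  have h_sqrt := (sqrt_one_sub_sq_pos ha).ne'
  have h_norm : 0 < ‖normChartPos a e q‖ := norm_pos_iff.2 hy
  have h_sinh := neg_mink_lift_first_sq_sub_one ha he hq
  have h_one : 1 < -mink q (lift (a • e)) := by
    have h_pos := neg_mink_lift_pos (by rwa [norm_smul_sq_of_norm_eq_one he]) hq
    have h_sq : 0 < (q.2 * ‖normChartPos a e q‖) ^ 2 := by positivity
    nlinarith
  have h_snd : W.2 = q.2⁻¹ * inner ℝ q.1 W.1 := by
    rw [mink] at hW
    field_simp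
    linarith
  have h_pos : axisScale (√(1 - a ^ 2)) e (normChartPos a e q) = q.2⁻¹ • q.1 - a • e := by
    rw [← axisScale_normChartPos_sub ha he q, map_sub, map_smul _ (signedHalfDist a),
      axisScale_self he, signedHalfDist, smul_smul, neg_mul, div_mul_cancel₀ _ h_sqrt]
    module
  rw [fderiv_keplerPot m _ h_one, h_sinh, Real.sqrt_sq (by positivity), h_pos, inner_sub_left,
    real_inner_smul_left, real_inner_smul_left]
  simp only [mink, lift, norm_smul_sq_of_norm_eq_one he, h_snd, real_inner_smul_right,
    real_inner_comm e W.1]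
  field_simp
  ring

lemma snd_mul_mink_eq_inner_chartVel {q W : Mink d} (hW : mink q W = 0) (A : Mink d) :
    q.2 * mink A W = inner ℝ (chartVel (q, A)) W.1 := by
  rw [mink] at hW ⊢
  rw [chartVel, inner_sub_left, real_inner_smul_left, real_inner_smul_left]
  linear_combination A.2 * hW

lemma snd_mul_fderiv_keplerPot (ha : a ^ 2 < 1) (he : ‖e‖ = 1) (m : ℝ) {q : Mink d}
    (hq : q ∈ Hyp d) (hy : normChartPos a e q ≠ 0) {W : Mink d} (hW : mink q W = 0) :
    q.2 * -fderiv ℝ (keplerPot m (lift (a • e))) q W = inner ℝ (axisScale (√(1 - a ^ 2)) e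
      (-(confFactor a e (normChartPos a e q) * (m / √(1 - a ^ 2)) / ‖normChartPos a e q‖ ^ 3) •
        normChartPos a e q)) W.1 := by
  have hq2 : q.2 ≠ 0 := hq.2.ne'
  have h_norm := norm_ne_zero_iff.2 hy
  have h_conf : confFactor a e (normChartPos a e q) = (q.2 ^ 2)⁻¹ :=
    eq_inv_of_mul_eq_one_right (snd_sq_mul_confFactor ha he hq)
  rw [fderiv_keplerPot_first ha he m hq hy hW, map_smul, real_inner_smul_left, h_conf]
  field_simp

lemma newton_iff_chartVel_eq (ha : a ^ 2 < 1) (he : ‖e‖ = 1) (m : ℝ) {q : Mink d}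
    (hq : q ∈ Hyp d) (hy : normChartPos a e q ≠ 0) (A : Mink d) :
    (∀ W : Mink d, mink q W = 0 → mink A W = -fderiv ℝ (keplerPot m (lift (a • e))) q W) ↔
      chartVel (q, A) = axisScale (√(1 - a ^ 2)) e
        (-(confFactor a e (normChartPos a e q) * (m / √(1 - a ^ 2)) / ‖normChartPos a e q‖ ^ 3) •
          normChartPos a e q) := by
  have hq2 : q.2 ≠ 0 := hq.2.ne'
  constructor
  · intro h
    refine ext_inner_right ℝ fun v => ?_
    have hW : mink q ((v, q.2⁻¹ * inner ℝ q.1 v) : Mink d) = 0 := by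
      rw [mink, mul_inv_cancel_left₀ hq2, sub_self]
    have h_newton := h _ hW
    rw [← snd_mul_mink_eq_inner_chartVel hW, h_newton, snd_mul_fderiv_keplerPot ha he m hq hy hW]
  · intro h W hW
    apply mul_left_cancel₀ hq2
    rw [snd_mul_mink_eq_inner_chartVel hW, snd_mul_fderiv_keplerPot ha he m hq hy hW, h]

lemma hasDerivAt_normChartPos (a : ℝ) (e : Eu d) {q : ℝ → Mink d} {v : Mink d} {t : ℝ}
    (hq : HasDerivAt q v t) (hq2 : (q t).2 ≠ 0) :
    HasDerivAt (fun t => normChartPos a e (q t))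
      (((q t).2 ^ 2)⁻¹ • normChartVel a e (q t, v)) t := by
  refine (((axisScale (√(1 - a ^ 2))⁻¹ e).hasFDerivAt.comp_hasDerivAt t
    (((hasDerivAt_snd_comp hq).fun_inv hq2).fun_smul (hasDerivAt_fst_comp hq))).add_const
      (signedHalfDist a • e)).congr_deriv ?_
  rw [normChartVel, ← map_smul (axisScale _ e), chartVel]
  congr 1
  match_scalars <;> field_simp

lemma hasDerivAt_chartVel {q v : ℝ → Mink d} {A : Mink d} {t : ℝ}
    (hq : HasDerivAt q (v t) t) (hv : HasDerivAt v A t) :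
    HasDerivAt (fun t => chartVel (q t, v t)) (chartVel (q t, A)) t := by
  refine (((hasDerivAt_snd_comp hq).fun_smul (hasDerivAt_fst_comp hv)).fun_sub
    ((hasDerivAt_snd_comp hv).fun_smul (hasDerivAt_fst_comp hq))).congr_deriv ?_
  rw [chartVel]
  module

lemma continuous_confFactor (a : ℝ) (e : Eu d) : Continuous (confFactor a e) :=
  continuous_const.mul (contDiff_chartFactor _ e).continuous

lemma IsKeplerMotion.isChartMotion (ha : a ^ 2 < 1) (he : ‖e‖ = 1) {m : ℝ} {q v : ℝ → Mink d}
    (h : IsKeplerMotion m (lift (a • e)) q v) :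
    IsChartMotion (m / √(1 - a ^ 2)) (fun t => confFactor a e (normChartPos a e (q t)))
      (fun t => normChartPos a e (q t)) (fun t => normChartVel a e (q t, v t)) := by
  have h_ne (t : ℝ) : normChartPos a e (q t) ≠ 0 := fun h_zero => h.ne_center t <| by
    rw [← ofNormChart_normChartPos ha he (h.mem_hyp t), h_zero, ofNormChart_zero ha he]
  have h_conf (t : ℝ) : confFactor a e (normChartPos a e (q t)) = ((q t).2 ^ 2)⁻¹ :=
    eq_inv_of_mul_eq_one_right (snd_sq_mul_confFactor ha he (h.mem_hyp t))
  have h_deriv (t : ℝ) := hasDerivAt_normChartPos a e (h.hasDerivAt_pos t) (h.mem_hyp t).2.ne'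
  refine ⟨h_ne, fun t => confFactor_normChartPos_pos ha he (h.mem_hyp t), ?_,
    fun t => by simpa only [h_conf] using h_deriv t, fun t => ?_⟩
  · exact (continuous_confFactor a e).comp
      (continuous_iff_continuousAt.2 fun t => (h_deriv t).continuousAt)
  · obtain ⟨A, hA, h_newton⟩ := h.newton t
    refine ((axisScale (√(1 - a ^ 2))⁻¹ e).hasFDerivAt.comp_hasDerivAt t
      (hasDerivAt_chartVel (h.hasDerivAt_pos t) hA)).congr_deriv ?_
    rw [(newton_iff_chartVel_eq ha he m (h.mem_hyp t) (h_ne t) A).1 h_newton,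
      axisScale_axisScale he, inv_mul_cancel₀ (sqrt_one_sub_sq_pos ha).ne', axisScale_one]

/-- The tangent vector of hyperbolic space at `lift x` whose velocity in the chart of central
projection is `w`. -/
def ofChartVel (x w : Eu d) : Mink d :=
  ((inner ℝ x w / √(1 - ‖x‖ ^ 2)) • x + √(1 - ‖x‖ ^ 2) • w, inner ℝ x w / √(1 - ‖x‖ ^ 2))

lemma chartVel_ofChartVel {x : Eu d} (hx : ‖x‖ ^ 2 < 1) (w : Eu d) :
    chartVel (lift x, ofChartVel x w) = w := by
  have h_ne : √(1 - ‖x‖ ^ 2) ≠ 0 := (Real.sqrt_pos.2 (by linarith)).ne'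
  rw [chartVel, lift, ofChartVel]
  match_scalars <;> field_simp
  ring

lemma ofChartVel_chartVel {z : Mink d × Mink d} (hz : z ∈ THyp d) :
    ofChartVel (z.1.2⁻¹ • z.1.1) (chartVel z) = z.2 := by
  have h_ne := hz.1.2.ne'
  have h_tangent := hz.2
  rw [mink] at h_tangent
  have h_inner : inner ℝ (z.1.2⁻¹ • z.1.1) (chartVel z) / z.1.2⁻¹ = z.2.2 := by
    rw [chartVel, real_inner_smul_left, inner_sub_right, real_inner_smul_right,
      real_inner_smul_right, real_inner_self_eq_norm_sq, norm_fst_sq_of_mem_hyp hz.1,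
      sub_eq_zero.1 h_tangent]
    field_simp
    ring
  rw [ofChartVel, sqrt_one_sub_norm_centralProjection_sq hz.1, h_inner, chartVel]
  refine Prod.ext ?_ rfl
  dsimp only
  match_scalars <;> field_simp
  ring

lemma hasDerivAt_lift {x : ℝ → Eu d} {w : Eu d} {t : ℝ} (hx : ‖x t‖ ^ 2 < 1)
    (h : HasDerivAt x ((1 - ‖x t‖ ^ 2) • w) t) :
    HasDerivAt (fun t => lift (x t)) (ofChartVel (x t) w) t := by
  have h_pos : 0 < 1 - ‖x t‖ ^ 2 := by linarith
  have h_ne : √(1 - ‖x t‖ ^ 2) ≠ 0 := (Real.sqrt_pos.2 h_pos).ne'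
  have h_sq : √(1 - ‖x t‖ ^ 2) ^ 2 = 1 - ‖x t‖ ^ 2 := Real.sq_sqrt h_pos.le
  have h_inv := ((h.norm_sq.const_sub 1).sqrt h_pos.ne').fun_inv h_ne
  refine ((h_inv.fun_smul h).prodMk h_inv).congr_deriv ?_
  rw [ofChartVel, real_inner_smul_right, ← h_sq, Real.sqrt_sq (Real.sqrt_nonneg _)]
  ext1 <;> dsimp only
  · match_scalars <;> field_simp
  · field_simp

lemma differentiableAt_ofChartVel {x w : ℝ → Eu d} {t : ℝ} (hx : DifferentiableAt ℝ x t)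
    (hw : DifferentiableAt ℝ w t) (h_lt : ‖x t‖ ^ 2 < 1) :
    DifferentiableAt ℝ (fun t => ofChartVel (x t) (w t)) t := by
  have h_pos : 0 < 1 - ‖x t‖ ^ 2 := by linarith
  have h_sqrt := ((hx.norm_sq ℝ).const_sub 1).sqrt h_pos.ne'
  have h_div := (hx.inner ℝ hw).fun_div h_sqrt (Real.sqrt_pos.2 h_pos).ne'
  exact ((h_div.fun_smul hx).fun_add (h_sqrt.fun_smul hw)).prodMk h_div

/-- The tangent vector of hyperbolic space at `ofNormChart a e y` with normalized velocity `w`. -/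
def ofNormChartVel (a : ℝ) (e y w : Eu d) : Mink d :=
  ofChartVel (axisScale (√(1 - a ^ 2)) e (y - signedHalfDist a • e)) (axisScale (√(1 - a ^ 2)) e w)

lemma hasDerivAt_ofNormChart (ha : a ^ 2 < 1) (he : ‖e‖ = 1) {y : ℝ → Eu d} {w : Eu d} {t : ℝ}
    (h_conf : 0 < confFactor a e (y t)) (hy : HasDerivAt y (confFactor a e (y t) • w) t) :
    HasDerivAt (fun t => ofNormChart a e (y t)) (ofNormChartVel a e (y t) w) t := by
  refine hasDerivAt_lift (norm_axisScale_sq_lt_one ha he h_conf) ?_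
  rw [one_sub_norm_axisScale_sq ha he, ← map_smul]
  exact (axisScale _ e).hasFDerivAt.comp_hasDerivAt t (hy.sub_const _)

lemma chartVel_ofNormChart (ha : a ^ 2 < 1) (he : ‖e‖ = 1) {y : Eu d}
    (hy : 0 < confFactor a e y) (w : Eu d) :
    chartVel (ofNormChart a e y, ofNormChartVel a e y w) = axisScale (√(1 - a ^ 2)) e w :=
  chartVel_ofChartVel (norm_axisScale_sq_lt_one ha he hy) _

lemma ofNormChartVel_normChartVel (ha : a ^ 2 < 1) (he : ‖e‖ = 1) {z : Mink d × Mink d}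
    (hz : z ∈ THyp d) : ofNormChartVel a e (normChartPos a e z.1) (normChartVel a e z) = z.2 := by
  rw [ofNormChartVel, axisScale_normChartPos_sub ha he, axisScale_normChartVel ha he,
    ofChartVel_chartVel hz]

lemma differentiableAt_ofNormChartVel (ha : a ^ 2 < 1) (he : ‖e‖ = 1) {y w : ℝ → Eu d} {t : ℝ}
    (hy : DifferentiableAt ℝ y t) (hw : DifferentiableAt ℝ w t)
    (h_conf : 0 < confFactor a e (y t)) :
    DifferentiableAt ℝ (fun t => ofNormChartVel a e (y t) (w t)) t :=
  differentiableAt_ofChartVel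
    ((axisScale _ e).differentiableAt.comp t (hy.sub_const (signedHalfDist a • e)))
    ((axisScale _ e).differentiableAt.comp t hw) (norm_axisScale_sq_lt_one ha he h_conf)

lemma IsChartMotion.isKeplerMotion (ha : a ^ 2 < 1) (he : ‖e‖ = 1) {m : ℝ} {y w : ℝ → Eu d}
    (h : IsChartMotion (m / √(1 - a ^ 2)) (fun t => confFactor a e (y t)) y w) :
    IsKeplerMotion m (lift (a • e)) (fun t => ofNormChart a e (y t))
      (fun t => ofNormChartVel a e (y t) (w t)) := by
  have h_pos (t : ℝ) : normChartPos a e (ofNormChart a e (y t)) = y t :=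
    normChartPos_ofNormChart ha he (h.factor_pos t)
  have h_mem (t : ℝ) : ofNormChart a e (y t) ∈ Hyp d :=
    lift_mem_hyp (norm_axisScale_sq_lt_one ha he (h.factor_pos t))
  have h_deriv (t : ℝ) := hasDerivAt_ofNormChart ha he (h.factor_pos t) (h.hasDerivAt_pos t)
  refine ⟨h_mem, fun t h_center => h.ne_zero t ?_, h_deriv, fun t => ?_⟩
  · have h_zero : 0 < confFactor a e 0 := by
      rw [confFactor_pos_iff ha]
      simp [chartFactor]
    rw [← h_pos t, h_center, ← ofNormChart_zero ha he, normChartPos_ofNormChart ha he h_zero]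
  · have h_vel := (differentiableAt_ofNormChartVel ha he (h.hasDerivAt_pos t).differentiableAt
      (h.hasDerivAt_vel t).differentiableAt (h.factor_pos t)).hasDerivAt
    refine ⟨_, h_vel, ?_⟩
    rw [newton_iff_chartVel_eq ha he m (h_mem t) (by rw [h_pos]; exact h.ne_zero t), h_pos]
    have h_chartVel := hasDerivAt_chartVel (h_deriv t) h_vel
    simp only [chartVel_ofNormChart ha he (h.factor_pos _)] at h_chartVel
    exact h_chartVel.unique
      ((axisScale _ e).hasFDerivAt.comp_hasDerivAt t (h.hasDerivAt_vel t))

lemma exists_isClosedOrbit (ha : a ^ 2 < 1) (he : ‖e‖ = 1) (m : ℝ) {z : Mink d × Mink d}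
    (hz : z ∈ THyp d)
    (hf : 0 < freqSq (m / √(1 - a ^ 2)) (normChart a e z))
    (h_ne : ∀ u, orbit (m / √(1 - a ^ 2)) (normChart a e z) u ≠ 0)
    (h_conf : ∀ u, 0 < confFactor a e
      (orbit (m / √(1 - a ^ 2)) (normChart a e z) u)) :
    ∃ q v T, IsClosedOrbit m (lift (a • e)) z q v T := by
  obtain ⟨y, w, T, hT, h_motion, hy, hw, h_periodic⟩ := exists_isChartMotion hf h_ne
    ((continuous_confFactor a e).comp (continuous_orbit _ _)) h_conf
  refine ⟨_, _, T, h_motion.isKeplerMotion ha he, ?_, hT, fun t => ?_⟩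
  · rw [hy, hw, normChart, ofNormChart_normChartPos ha he hz.1,
      ofNormChartVel_normChartVel ha he hz]
  · simp only [h_periodic t]

end KeplerMotion

/-! ### The averaged energy -/

section Averaging

variable {d : ℕ} {a m : ℝ} {e : Eu d}

/-- The mean of `V` over the Kepler orbit with initial data `z` with respect to the hyperbolic
time, which is proportional to `weight h e y du` in terms of the eccentric anomaly `u`. -/
def orbitAverage (μ h : ℝ) (e : Eu d) (V : Eu d → ℝ) (z : Eu d × Eu d) : ℝ :=
  orbitIntegral μ (fun y => weight h e y * V y) z / orbitIntegral μ (weight h e) z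

/-- In the normalized chart, a combination of the potentials of the second Kepler center and of
the Hooke center. -/
def chartPert (a : ℝ) (e : Eu d) (α β : ℝ) (y : Eu d) : ℝ :=
  α * secondPot (signedHalfDist a) e y + β * (1 - confFactor a e y)

lemma weight_mul_chartPert (α β : ℝ) {y : Eu d} (hy : chartFactor (signedHalfDist a) e y ≠ 0) :
    weight (signedHalfDist a) e y * chartPert a e α β y =
      invariantIntegrand (signedHalfDist a) e α β (-(β * (1 - a ^ 2))) y := by
  rw [chartPert, invariantIntegrand, confFactor, weight]
  field_simp
  ring

lemma IsAdmissible.continuous_chartPert {μ : ℝ} {z : Eu d × Eu d}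
    (hz : IsAdmissible μ (signedHalfDist a) e z) (α β : ℝ) :
    Continuous fun u => chartPert a e α β (orbit μ z u) := by
  have h_second : Continuous fun u => secondPot (signedHalfDist a) e (orbit μ z u) :=
    continuous_iff_continuousAt.2 fun u =>
      (contDiffAt_secondPot (hz.orbit_ne_second u)).continuousAt.comp
        (continuous_orbit μ z).continuousAt
  exact (continuous_const.mul h_second).add (continuous_const.mul
    (continuous_const.sub ((continuous_confFactor a e).comp (continuous_orbit μ z))))

lemma IsAdmissible.isInvariantAt_orbitAverage_chartPert (he : ‖e‖ = 1) {μ : ℝ} {z : Eu d × Eu d}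
    (hz : IsAdmissible μ (signedHalfDist a) e z) (α β : ℝ) :
    IsInvariantAt (orbitAverage μ (signedHalfDist a) e (chartPert a e α β)) z
      (hamField μ (signedHalfDist a) e z) := by
  have h_weight : orbitIntegral μ (weight (signedHalfDist a) e) =
      orbitIntegral μ (invariantIntegrand (signedHalfDist a) e 0 1 0) := by
    congr
    funext y
    simp only [invariantIntegrand, zero_mul, zero_add, one_mul, add_zero]
  have h_pert : orbitIntegral μ (fun y => weight (signedHalfDist a) e y * chartPert a e α β y)
      =ᶠ[nhds z] orbitIntegral μ
        (invariantIntegrand (signedHalfDist a) e α β (-(β * (1 - a ^ 2)))) :=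
    hz.eventually.mono fun z' hz' => intervalIntegral.integral_congr fun u _ =>
      weight_mul_chartPert α β (hz'.chartFactor_pos u).ne'
  refine ((hz.isInvariantAt_orbitIntegral he α β _).congr_of_eventuallyEq h_pert).div ?_
    hz.orbitIntegral_weight_pos.ne'
  rw [h_weight]
  exact hz.isInvariantAt_orbitIntegral he 0 1 0

lemma IsClosedOrbit.vel_period {T : ℝ} {Z : Mink d} {z : Mink d × Mink d}
    {q v : ℝ → Mink d} (h : IsClosedOrbit m Z z q v T) : v T = v 0 := by
  have h_shift : HasDerivAt (fun t => q (t + T)) (v T) 0 :=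
    HasDerivAt.comp_add_const 0 T (by simpa only [zero_add] using h.motion.hasDerivAt_pos T)
  exact h_shift.unique (by simpa only [h.periodic _] using h.motion.hasDerivAt_pos 0)

lemma norm_div_confFactor (a : ℝ) (e y : Eu d) :
    ‖y‖ / confFactor a e y = (1 - a ^ 2)⁻¹ * weight (signedHalfDist a) e y := by
  rw [confFactor, weight, ← div_div, div_right_comm, div_eq_inv_mul]

lemma IsChartMotion.mean_eq_orbitAverage (ha : a ^ 2 < 1) {μ T : ℝ} {y w : ℝ → Eu d}
    (hm : IsChartMotion μ (fun t => confFactor a e (y t)) y w) (hμ : 0 < μ) (hT : 0 < T)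
    (hy : y T = y 0) (hw : w T = w 0) {V : Eu d → ℝ}
    (hV : Continuous fun u => V (orbit μ (y 0, w 0) u)) :
    T⁻¹ * ∫ t in (0 : ℝ)..T, V (y t) =
      orbitAverage μ (signedHalfDist a) e V (y 0, w 0) := by
  obtain ⟨K, hK, h_integral⟩ := hm.exists_integral_eq_mul_orbitIntegral (P := confFactor a e)
    hμ hT hy hw ((continuous_confFactor a e).comp (continuous_orbit _ _))
  have h_weight (V : Eu d → ℝ) :
      orbitIntegral μ (fun y => ‖y‖ / confFactor a e y * V y) (y 0, w 0) =
        (1 - a ^ 2)⁻¹ *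
          orbitIntegral μ (fun y => weight (signedHalfDist a) e y * V y) (y 0, w 0) := by
    simp only [orbitIntegral, ← intervalIntegral.integral_const_mul, norm_div_confFactor, mul_assoc]
  have h_period : T = K * ((1 - a ^ 2)⁻¹ *
      orbitIntegral μ (weight (signedHalfDist a) e) (y 0, w 0)) := by
    have h_one := h_integral (fun _ => 1) continuous_const
    rw [h_weight] at h_one
    simpa only [intervalIntegral.integral_const, sub_zero, smul_eq_mul, mul_one] using h_one
  have h_factor : (1 - a ^ 2)⁻¹ ≠ 0 := inv_ne_zero (by linarith)
  rw [h_integral V hV, h_weight, ← div_eq_inv_mul, h_period, mul_div_mul_left _ _ hK,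
    mul_div_mul_left _ _ h_factor, orbitAverage]

lemma IsClosedOrbit.mean_eq_orbitAverage (ha : a ^ 2 < 1) (he : ‖e‖ = 1) (hm : 0 < m) {T : ℝ}
    {z : Mink d × Mink d} {q v : ℝ → Mink d} (h : IsClosedOrbit m (lift (a • e)) z q v T)
    {V : Eu d → ℝ} (hV : Continuous fun u =>
      V (orbit (m / √(1 - a ^ 2)) (normChart a e z) u)) :
    T⁻¹ * ∫ t in (0 : ℝ)..T, V (normChartPos a e (q t)) =
      orbitAverage (m / √(1 - a ^ 2)) (signedHalfDist a) e V (normChart a e z) := by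
  obtain rfl := h.start
  have hq : q T = q 0 := by simpa only [zero_add] using h.periodic 0
  exact (h.motion.isChartMotion ha he).mean_eq_orbitAverage ha
    (div_pos hm (sqrt_one_sub_sq_pos ha)) h.period_pos (by rw [hq]) (by rw [hq, h.vel_period]) hV

lemma orbitMean_eq_orbitAverage (ha : a ^ 2 < 1) (he : ‖e‖ = 1) (hm : 0 < m)
    {z : Mink d × Mink d} (hz : z ∈ THyp d)
    (h_adm : IsAdmissible (m / √(1 - a ^ 2)) (signedHalfDist a) e (normChart a e z))
    {V : Mink d → ℝ} {α β : ℝ}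
    (hV : ∀ q ∈ Hyp d, V q = chartPert a e α β (normChartPos a e q)) :
    orbitMean m (lift (a • e)) V z = orbitAverage (m / √(1 - a ^ 2)) (signedHalfDist a) e
      (chartPert a e α β) (normChart a e z) := by
  obtain ⟨q, v, T, h⟩ := exists_isClosedOrbit ha he m hz h_adm.freqSq_pos h_adm.orbit_ne_zero
    fun u => (confFactor_pos_iff ha).2 (h_adm.chartFactor_pos u)
  have h_exists : ∃ o : (ℝ → Mink d) × (ℝ → Mink d) × ℝ,
      IsClosedOrbit m (lift (a • e)) z o.1 o.2.1 o.2.2 := ⟨(q, v, T), h⟩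
  rw [orbitMean, dif_pos h_exists]
  simp only [hV _ (h_exists.choose_spec.motion.mem_hyp _)]
  exact h_exists.choose_spec.mean_eq_orbitAverage ha he hm (h_adm.continuous_chartPert α β)

lemma isAdmissible_of_mem_region (ha : a ^ 2 < 1) (he : ‖e‖ = 1) (hm : 0 < m)
    {z : Mink d × Mink d} (hz : z ∈ region m (lift (a • e)) (lift (-a • e))) :
    IsAdmissible (m / √(1 - a ^ 2)) (signedHalfDist a) e (normChart a e z) := by
  obtain ⟨-, q, v, T, h, h_ne⟩ := hz
  obtain rfl := h.start
  have hμ := div_pos hm (sqrt_one_sub_sq_pos ha)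
  have h_motion := h.motion.isChartMotion ha he
  have hq : q T = q 0 := by simpa only [zero_add] using h.periodic 0
  have hy : normChartPos a e (q T) = normChartPos a e (q 0) := by rw [hq]
  have hw : normChartVel a e (q T, v T) = normChartVel a e (q 0, v 0) := by
    rw [hq, h.vel_period]
  have h_orbit (u : ℝ) : ∃ t, orbit (m / √(1 - a ^ 2)) (normChart a e (q 0, v 0)) u =
      normChartPos a e (q t) := h_motion.exists_orbit_eq hμ h.period_pos hy hw u
  refine ⟨h_motion.freqSq_pos hμ h.period_pos hy hw, fun u => ?_, fun u => ?_, fun u => ?_⟩ <;>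
    obtain ⟨t, ht⟩ := h_orbit u <;> rw [ht]
  · exact h_motion.ne_zero t
  · exact (confFactor_pos_iff ha).1 (h_motion.factor_pos t)
  · intro h_second
    apply h_ne t
    rw [← ofNormChart_normChartPos ha he (h.motion.mem_hyp t), h_second, ofNormChart_second ha he]

lemma isAdmissible_chartMap_toCanonical (ha : a ^ 2 < 1) (he : ‖e‖ = 1) (hm : 0 < m)
    {z : Mink d × Mink d} (hz : z ∈ region m (lift (a • e)) (lift (-a • e))) :
    IsAdmissible (m / √(1 - a ^ 2)) (signedHalfDist a) e (chartMap a e (toCanonical z)) := by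
  rw [chartMap, ofCanonical_toCanonical hz.1]
  exact isAdmissible_of_mem_region ha he hm hz

/-- The Hamiltonian of the partially averaged system in the normalized chart. -/
def chartAveragedEnergy (μ a : ℝ) (e : Eu d) (α β : ℝ) (z : Eu d × Eu d) : ℝ :=
  chartEnergy μ (signedHalfDist a) e z +
    orbitAverage μ (signedHalfDist a) e (chartPert a e α β) z

lemma averagedEnergy_comp_ofCanonical_eventuallyEq (ha : a ^ 2 < 1) (he : ‖e‖ = 1) (hm : 0 < m)
    {c : Eu d × Eu d}
    (hc : IsAdmissible (m / √(1 - a ^ 2)) (signedHalfDist a) e (chartMap a e c))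
    {V : Mink d → ℝ} {α β : ℝ} (hV : ∀ q ∈ Hyp d, V q = chartPert a e α β (normChartPos a e q)) :
    averagedEnergy m (lift (a • e)) V ∘ ofCanonical =ᶠ[nhds c]
      chartAveragedEnergy (m / √(1 - a ^ 2)) a e α β ∘ chartMap a e := by
  filter_upwards [(contDiff_chartMap a e).continuous.continuousAt.eventually hc.eventually]
    with c' hc'
  exact congrArg₂ _ (keplerEnergy_ofCanonical ha he m hc'.fst_ne_zero)
    (orbitMean_eq_orbitAverage ha he hm (ofCanonical_mem c') hc' hV)

lemma diffAtTHyp_averagedEnergy_and_poisson_D_eq_zero (ha : a ^ 2 < 1) (he : ‖e‖ = 1)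
    (hm : 0 < m) {z : Mink d × Mink d} (hz : z ∈ region m (lift (a • e)) (lift (-a • e)))
    {V : Mink d → ℝ} {α β : ℝ} (hV : ∀ q ∈ Hyp d, V q = chartPert a e α β (normChartPos a e q)) :
    DiffAtTHyp (averagedEnergy m (lift (a • e)) V) z ∧
      poisson (averagedEnergy m (lift (a • e)) V) (D m a e) z = 0 := by
  have h_adm := isAdmissible_chartMap_toCanonical ha he hm hz
  have h_eq := averagedEnergy_comp_ofCanonical_eventuallyEq ha he hm h_adm hV
  have h_inv : IsInvariantAt (chartAveragedEnergy (m / √(1 - a ^ 2)) a e α β) _ _ :=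
    (isInvariantAt_chartEnergy he h_adm.fst_ne_zero _ _).add
      (h_adm.isInvariantAt_orbitAverage_chartPert he α β)
  have h_chartMap := (contDiff_chartMap a e).differentiable one_ne_zero (toCanonical z)
  refine ⟨(h_inv.differentiableAt.comp _ h_chartMap).congr_of_eventuallyEq h_eq, ?_⟩
  have h_bracket := canonicalBracket_comp_chartMap ha he (m / √(1 - a ^ 2)) h_adm.fst_ne_zero
    h_inv.differentiableAt
  rw [h_inv.fderiv_apply] at h_bracket
  rw [poisson, D_comp_ofCanonical ha he m, ← h_bracket, canonicalBracket, canonicalBracket,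
    h_eq.fderiv_eq]

lemma diffAtTHyp_D (ha : a ^ 2 < 1) (he : ‖e‖ = 1) (hm : 0 < m) {z : Mink d × Mink d}
    (hz : z ∈ region m (lift (a • e)) (lift (-a • e))) : DiffAtTHyp (D m a e) z := by
  have h_ne := (isAdmissible_chartMap_toCanonical ha he hm hz).fst_ne_zero
  rw [DiffAtTHyp, D_comp_ofCanonical ha he m]
  exact (hasFDerivAt_chartD _ _ e h_ne).differentiableAt.comp _
    ((contDiff_chartMap a e).differentiable one_ne_zero _)

lemma twoCenterPert_eq_chartPert (ha : a ^ 2 < 1) (he : ‖e‖ = 1) (m : ℝ) {q : Mink d}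
    (hq : q ∈ Hyp d) :
    twoCenterPert m a e q = chartPert a e (-(m * √(1 - a ^ 2))) 0 (normChartPos a e q) := by
  rw [twoCenterPert, keplerPot_second ha he m hq, chartPert]
  ring

lemma lagrangePert_eq_chartPert (ha : a ^ 2 < 1) (he : ‖e‖ = 1) (m f : ℝ) {q : Mink d}
    (hq : q ∈ Hyp d) :
    lagrangePert m f a e q = chartPert a e (-(m * √(1 - a ^ 2))) f (normChartPos a e q) := by
  rw [lagrangePert, keplerPot_second ha he m hq, hookePot_midpoint ha he f hq, chartPert]
  ring

end Averaging

end HypKepler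

end

theorem mainTheorem6 (d : ℕ) (e : HypKepler.Eu d) (he : ‖e‖ = 1)
    (a : ℝ) (ha : 0 < a) (ha1 : a < 1) (m₁ : ℝ) (hm₁ : 0 < m₁) (m₂ f : ℝ)
    (z : HypKepler.Mink d × HypKepler.Mink d)
    (hz : z ∈ HypKepler.region m₁ (HypKepler.lift (a • e)) (HypKepler.lift (-a • e))) :
    HypKepler.DiffAtTHyp (HypKepler.D m₁ a e) z ∧
    (HypKepler.DiffAtTHyp (HypKepler.averagedEnergy m₁ (HypKepler.lift (a • e))
        (HypKepler.twoCenterPert m₂ a e)) z ∧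
      HypKepler.poisson (HypKepler.averagedEnergy m₁ (HypKepler.lift (a • e))
        (HypKepler.twoCenterPert m₂ a e)) (HypKepler.D m₁ a e) z = 0) ∧
    (HypKepler.DiffAtTHyp (HypKepler.averagedEnergy m₁ (HypKepler.lift (a • e))
        (HypKepler.lagrangePert m₂ f a e)) z ∧
      HypKepler.poisson (HypKepler.averagedEnergy m₁ (HypKepler.lift (a • e))
        (HypKepler.lagrangePert m₂ f a e)) (HypKepler.D m₁ a e) z = 0) := by
  have ha2 : a ^ 2 < 1 := by nlinarith
  exact ⟨HypKepler.diffAtTHyp_D ha2 he hm₁ hz,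
    HypKepler.diffAtTHyp_averagedEnergy_and_poisson_D_eq_zero ha2 he hm₁ hz fun _ hq =>
      HypKepler.twoCenterPert_eq_chartPert ha2 he m₂ hq,
    HypKepler.diffAtTHyp_averagedEnergy_and_poisson_D_eq_zero ha2 he hm₁ hz fun _ hq =>
      HypKepler.lagrangePert_eq_chartPert ha2 he m₂ f hq⟩
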